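/- Let $k$ be a field of characteristic zero and $W=\bigoplus_d W_d$ a $\mathbb Z$-graded $k$-vector space. For $n\ge 1$ let $\mathrm{Gr}(n)$ be the vector space spanned by connected oriented acyclic graphs (oriented trees) with vertex set $\{1,\dots,n\}$, and let $$\mathbb G^n(W)=\bigl(\mathrm{Gr}(n)\otimes W^{\otimes n}\bigr)_{\Sigma_n},\qquad \mathbb G(W)=\bigoplus_{n\ge1}\mathbb G^n(W),$$ where $\Sigma_n$ acts on $W^{\otimes n}$ with Koszul signs. The graph cobracket $]\cdot[\,:\mathbb G(W)\to\mathbb G(W)\otimes\mathbb G(W)$ is $$]G\otimes w_1\otimes\cdots\otimes w_n[\;=\sum_e\bigl((-1)^{\kappa_1}\gamma_1^{\hat e}\otimes\gamma_2^{\hat e}-(-1)^{\kappa_2}\gamma_2^{\hat e}\otimes\gamma_1^{\hat e}\bigr),$$ the sum over the edges $e$ of $G$, where removing $e$ splits the labelled graph into the labelled graphs $\gamma_1^{\hat e}$ and $\gamma_2^{\hat e}$, with $e$ pointing from the first to the second (vertices renumbered in increasing order), and $(-1)^{\kappa_1},(-1)^{\kappa_2}$ are the Koszul signs of the reordering of the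 $w_i$. Let $\mathrm{Arn}(W)\subset\mathbb G(W)$ be the subspace spanned by the arrow-reversing expressions $G+G'$ ($G,G'$ differing only in the direction of one edge) and the Arnold expressions $G_1+G_2+G_3$ (equal except that they contain respectively $a\to b\to c$, $b\to c\to a$, $c\to a\to b$, for vertices $a,b,c$), with the same labels on all terms. Let $\mathbb E(W)=\mathbb G(W)/\mathrm{Arn}(W)$ with the induced cobracket, and $\mathbb E^n(W)$ the image of $\mathbb G^n(W)$. (If $W$ is concentrated in positive degrees, $\mathbb E(W)$ is the graph model of the cofree Lie coalgebra on $W$.) On either coalgebra $C$, the iterated cobracket $]\cdot[^m:C\to C^{\otimes(m+1)}$ is defined by $]g[^0=g$ and $]g[^m=\sum\,]g_1[^{m-1}\otimes g_2$, where $]g[\;=\sum g_1\otimes g_2$. **Proposition.** Let $n\ge1$. 1. An element $g\in\mathbb E^n(W)$ is zero if and only if $]g[^{n-1}=0$ in $\mathbb E(W)^{\otimes n}$. 2. (Criterion for the word problem on graph representatives.) For $\gamma\in\mathbb G^n(W)$ the iterated cobracket $]\gamma[^{n-1}$, computed by cutting edges, lies in the subspace $\mathbb G^1(W)^{\otimes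 n}=W^{\otimes n}$ of $\mathbb G(W)^{\otimes n}$, and $\gamma$ represents zero in $\mathbb E^n(W)$, i.e. $\gamma\in\mathrm{Arn}(W)$, if and only if $]\gamma[^{n-1}=0$. -/

import Mathlib

open scoped TensorProduct

namespace GraphCoalgebra

/-! ### Oriented trees -/

/-- A binary relation is read as a set of arrows; it is an oriented tree if no two vertices are
joined by arrows in both directions (in particular there are no loops) and the underlying
undirected graph is connected and acyclic. -/
def IsOrientedTree {V : Type*} (r : V → V → Prop) : Prop :=
  (∀ a b, r a b → ¬ r b a) ∧ (SimpleGraph.fromRel r).IsTree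

/-- A `V`-graph: a connected oriented acyclic graph with vertex set `V`. -/
@[ext] structure OrientedTree (V : Type*) where
  arrow : V → V → Prop
  isOrientedTree : IsOrientedTree arrow

namespace OrientedTree

variable {V : Type*} (G : OrientedTree V)

/-- The underlying undirected graph. -/
def toSimple : SimpleGraph V := SimpleGraph.fromRel G.arrow

/-- The type of edges of `G`: an edge `e` points from `e.1.1` to `e.1.2`. -/
abbrev Edge : Type _ := {e : V × V // G.arrow e.1 e.2}

/-- The undirected graph obtained from `G` by removing the edge `e`. -/
def cut (e : G.Edge) : SimpleGraph V := G.toSimple.deleteEdges {s(e.1.1, e.1.2)}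

open Classical in
/-- Vertices of the connected component of `G` minus `e` that `e` points away from. -/
noncomputable def srcSide [Fintype V] (e : G.Edge) : Finset V :=
  Finset.univ.filter fun v => (G.cut e).Reachable e.1.1 v

open Classical in
/-- Vertices of the connected component of `G` minus `e` that `e` points to. -/
noncomputable def tgtSide [Fintype V] (e : G.Edge) : Finset V :=
  Finset.univ.filter fun v => (G.cut e).Reachable e.1.2 v

theorem toSimple_adj {a b : V} : G.toSimple.Adj a b ↔ G.arrow a b ∨ G.arrow b a := by
  unfold toSimple
  rw [SimpleGraph.fromRel_adj]
  constructor
  · exact fun h => h.2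
  · intro h
    refine ⟨?_, h⟩
    rintro rfl
    rcases h with h | h <;> exact G.isOrientedTree.1 _ _ h h

theorem cut_adj (e : G.Edge) {a b : V} :
    (G.cut e).Adj a b ↔ (G.arrow a b ∨ G.arrow b a) ∧
      ¬ ((a = e.1.1 ∧ b = e.1.2) ∨ (a = e.1.2 ∧ b = e.1.1)) := by
  unfold cut
  rw [SimpleGraph.deleteEdges_adj, toSimple_adj, Set.mem_singleton_iff, Sym2.eq_iff]

theorem not_reachable_cut (e : G.Edge) : ¬ (G.cut e).Reachable e.1.1 e.1.2 := by
  have hac : G.toSimple.IsAcyclic := G.isOrientedTree.2.2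
  rw [SimpleGraph.isAcyclic_iff_forall_adj_isBridge] at hac
  have h := hac (G.toSimple_adj.2 (Or.inl e.2))
  rw [SimpleGraph.isBridge_iff] at h
  exact h

theorem reachable_cut (e : G.Edge) (v : V) :
    (G.cut e).Reachable e.1.1 v ∨ (G.cut e).Reachable e.1.2 v := by
  have hc : G.toSimple.Connected := G.isOrientedTree.2.1
  have h := (SimpleGraph.reachable_iff_reflTransGen _ _).1 (hc.preconnected e.1.1 v)
  induction h with
  | refl => exact Or.inl (SimpleGraph.Reachable.refl _)
  | @tail x y _ hxy ih =>
    by_cases hx : (x = e.1.1 ∧ y = e.1.2) ∨ (x = e.1.2 ∧ y = e.1.1)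
    · rcases hx with ⟨_, rfl⟩ | ⟨_, rfl⟩
      · exact Or.inr (SimpleGraph.Reachable.refl _)
      · exact Or.inl (SimpleGraph.Reachable.refl _)
    · have hadj : (G.cut e).Adj x y := (G.cut_adj e).2 ⟨G.toSimple_adj.1 hxy, hx⟩
      exact ih.imp (fun h => h.trans hadj.reachable) (fun h => h.trans hadj.reachable)

theorem mem_srcSide [Fintype V] (e : G.Edge) (v : V) :
    v ∈ G.srcSide e ↔ (G.cut e).Reachable e.1.1 v := by
  simp [srcSide]

theorem mem_tgtSide [Fintype V] (e : G.Edge) (v : V) :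
    v ∈ G.tgtSide e ↔ (G.cut e).Reachable e.1.2 v := by
  simp [tgtSide]

theorem tgtSide_eq_compl [Fintype V] [DecidableEq V] (e : G.Edge) :
    G.tgtSide e = (G.srcSide e)ᶜ := by
  ext v
  rw [Finset.mem_compl, mem_srcSide, mem_tgtSide]
  constructor
  · intro h h'
    exact G.not_reachable_cut e (h'.trans h.symm)
  · intro h
    exact (G.reachable_cut e v).resolve_left h

/-- The restriction of a tree to a subset that induces a connected subgraph, with the vertices
renumbered in increasing order. -/
noncomputable def restrict {n : ℕ} (G : OrientedTree (Fin n)) (S : Finset (Fin n))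
    (hS : (G.toSimple.induce (S : Set (Fin n))).Connected) : OrientedTree (Fin S.card) where
  arrow i j := G.arrow (S.orderEmbOfFin rfl i) (S.orderEmbOfFin rfl j)
  isOrientedTree := by
    have hcomap : SimpleGraph.fromRel
        (fun i j => G.arrow (S.orderEmbOfFin rfl i) (S.orderEmbOfFin rfl j)) =
        G.toSimple.comap (S.orderEmbOfFin rfl) := by
      ext i j
      simp [toSimple, SimpleGraph.fromRel_adj, SimpleGraph.comap_adj]
    refine ⟨fun a b h => G.isOrientedTree.1 _ _ h, ?_⟩
    rw [hcomap]
    refine ⟨?_, ?_⟩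
    · have hiso := SimpleGraph.Iso.comap (S.orderIsoOfFin rfl).toEquiv
        (G.toSimple.induce (S : Set (Fin n)))
      exact hiso.connected_iff.2 hS
    · have hac : G.toSimple.IsAcyclic := G.isOrientedTree.2.2
      exact hac.of_comap (S.orderEmbOfFin rfl).toEmbedding

theorem connected_of_reachable {H : SimpleGraph V} (K : SimpleGraph V) (hle : K ≤ H) (a : V)
    (S : Set V) (hS : ∀ v, v ∈ S ↔ K.Reachable a v) : (H.induce S).Connected := by
  have ha : a ∈ S := (hS a).2 (SimpleGraph.Reachable.refl _)
  have key : ∀ v, K.Reachable a v → ∀ hv : v ∈ S, (H.induce S).Reachable ⟨a, ha⟩ ⟨v, hv⟩ := by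
    intro v h
    rw [SimpleGraph.reachable_iff_reflTransGen] at h
    induction h with
    | refl => exact fun _ => SimpleGraph.Reachable.refl _
    | @tail x y hax hxy ih =>
      intro hy
      have hx : x ∈ S := (hS x).2 ((SimpleGraph.reachable_iff_reflTransGen _ _).2 hax)
      have hadj : (H.induce S).Adj ⟨x, hx⟩ ⟨y, hy⟩ := hle hxy
      exact (ih hx).trans hadj.reachable
  refine (SimpleGraph.connected_iff_exists_forall_reachable _).2 ⟨⟨a, ha⟩, ?_⟩
  rintro ⟨v, hv⟩
  exact key v ((hS v).1 hv) hv

theorem connected_srcSide [Fintype V] (e : G.Edge) :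
    (G.toSimple.induce (G.srcSide e : Set V)).Connected :=
  connected_of_reachable (G.cut e) (SimpleGraph.deleteEdges_le _) e.1.1 _
    (fun v => by rw [Finset.mem_coe, mem_srcSide])

theorem connected_tgtSide [Fintype V] (e : G.Edge) :
    (G.toSimple.induce (G.tgtSide e : Set V)).Connected :=
  connected_of_reachable (G.cut e) (SimpleGraph.deleteEdges_le _) e.1.2 _
    (fun v => by rw [Finset.mem_coe, mem_tgtSide])

/-- `G` and `G'` differ by the direction of a single edge. -/
def ArrowReversal (G G' : OrientedTree V) : Prop :=
  ∃ (r : V → V → Prop) (a b : V),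
    (∀ i j, G.arrow i j ↔ r i j ∨ (i = a ∧ j = b)) ∧
    (∀ i j, G'.arrow i j ↔ r i j ∨ (i = b ∧ j = a))

/-- `G₁`, `G₂`, `G₃` are the three terms of an Arnold relation: they share the arrows `r` and have
in addition, respectively, `a → b → c`, `b → c → a` and `c → a → b`. (As all three are trees, `a`,
`b`, `c` are distinct, and `r` has no arrow between two of them.) -/
def ArnoldTriple (G₁ G₂ G₃ : OrientedTree V) : Prop :=
  ∃ (r : V → V → Prop) (a b c : V), ¬ r a b ∧ ¬ r b c ∧ ¬ r c a ∧
    (∀ i j, G₁.arrow i j ↔ r i j ∨ (i = a ∧ j = b) ∨ (i = b ∧ j = c)) ∧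
    (∀ i j, G₂.arrow i j ↔ r i j ∨ (i = b ∧ j = c) ∨ (i = c ∧ j = a)) ∧
    (∀ i j, G₃.arrow i j ↔ r i j ∨ (i = c ∧ j = a) ∨ (i = a ∧ j = b))

end OrientedTree

/-! ### Koszul signs -/

/-- The Koszul sign for moving homogeneous elements of degrees `d i` from the positions `i` to the
positions `f i`. -/
def koszulSign {n m : ℕ} (d : Fin n → ℤ) (f : Fin n → Fin m) : ℤˣ :=
  ∏ i, ∏ j, if i < j ∧ f j < f i then (d i * d j).negOnePow else 1

/-- The Koszul sign for reordering a list of homogeneous elements of degrees `d` so that those with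
index in `S` come first, followed by those with index in `T`, each part keeping its order. -/
def unshuffleSign {n : ℕ} (d : Fin n → ℤ) (S T : Finset (Fin n)) : ℤˣ :=
  ∏ i ∈ S, ∏ j ∈ T, if j < i then (d i * d j).negOnePow else 1

/-! ### The graph coalgebra and its Lie quotient -/

section Coalgebra

/-- An oriented tree on the vertices `0, …, size - 1` together with homogeneous elements of the
graded vector space `W` labelling the vertices: a generator `G ⊗ w₁ ⊗ ⋯ ⊗ wₙ`. -/
structure LabeledTree (W : ℤ → Type*) where
  size : ℕ
  graph : OrientedTree (Fin size)
  label : Fin size → Σ d, W d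

namespace LabeledTree

variable {W : ℤ → Type*}

/-- The degrees of the labels. -/
def deg (x : LabeledTree W) (i : Fin x.size) : ℤ := (x.label i).1

/-- The restriction of a labelled tree to a connected set of vertices. -/
noncomputable def restrict (x : LabeledTree W) (S : Finset (Fin x.size))
    (hS : (x.graph.toSimple.induce (S : Set (Fin x.size))).Connected) : LabeledTree W where
  size := S.card
  graph := x.graph.restrict S hS
  label i := x.label (S.orderEmbOfFin rfl i)

/-- The part of `x` that the edge `e` points away from, after removing `e`. -/
noncomputable def srcPart (x : LabeledTree W) (e : x.graph.Edge) : LabeledTree W :=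
  x.restrict (x.graph.srcSide e) (x.graph.connected_srcSide e)

/-- The part of `x` that the edge `e` points to, after removing `e`. -/
noncomputable def tgtPart (x : LabeledTree W) (e : x.graph.Edge) : LabeledTree W :=
  x.restrict (x.graph.tgtSide e) (x.graph.connected_tgtSide e)

end LabeledTree

variable (k : Type*) [Field k] (W : ℤ → Type*) [∀ d, AddCommGroup (W d)] [∀ d, Module k (W d)]

/-- The relations among labelled trees: multilinearity in the labels (`add`, `smul`), and
identification of labelled trees that differ by a renumbering of the vertices, up to the Koszul
sign (`perm`). -/
inductive GraphRel : (LabeledTree W →₀ k) → Prop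
  | add {n : ℕ} (G : OrientedTree (Fin n)) (w : Fin n → Σ d, W d) (i : Fin n) (d : ℤ) (a b : W d) :
      GraphRel (Finsupp.single ⟨n, G, Function.update w i ⟨d, a + b⟩⟩ 1
        - Finsupp.single ⟨n, G, Function.update w i ⟨d, a⟩⟩ 1
        - Finsupp.single ⟨n, G, Function.update w i ⟨d, b⟩⟩ 1)
  | smul {n : ℕ} (G : OrientedTree (Fin n)) (w : Fin n → Σ d, W d) (i : Fin n) (d : ℤ) (c : k)
      (a : W d) :
      GraphRel (Finsupp.single ⟨n, G, Function.update w i ⟨d, c • a⟩⟩ 1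
        - c • Finsupp.single ⟨n, G, Function.update w i ⟨d, a⟩⟩ 1)
  | perm (x y : LabeledTree W) (σ : Fin x.size ≃ Fin y.size)
      (harrow : ∀ i j, x.graph.arrow i j ↔ y.graph.arrow (σ i) (σ j))
      (hlabel : ∀ i, x.label i = y.label (σ i)) :
      GraphRel (Finsupp.single x 1 - koszulSign x.deg σ • Finsupp.single y 1)

/-- `⨁ₙ (Gr(n) ⊗ W^{⊗n})_{Σₙ}`: the space underlying the graph coalgebra on `W`. -/
abbrev GraphSpace : Type _ := (LabeledTree W →₀ k) ⧸ Submodule.span k {z | GraphRel k W z}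

variable {W} in
/-- The class of a labelled tree. -/
noncomputable def cls (x : LabeledTree W) : GraphSpace k W :=
  Submodule.Quotient.mk (Finsupp.single x 1)

/-- The weight `n` part of the graph coalgebra: the span of the trees with `n` vertices. -/
noncomputable def graphWeight (n : ℕ) : Submodule k (GraphSpace k W) :=
  Submodule.span k {z | ∃ x : LabeledTree W, x.size = n ∧ z = cls k x}

/-- The arrow-reversing and Arnold expressions. -/
inductive ArnRel : GraphSpace k W → Prop
  | reverse {n : ℕ} (G G' : OrientedTree (Fin n)) (w : Fin n → Σ d, W d)
      (h : G.ArrowReversal G') : ArnRel (cls k ⟨n, G, w⟩ + cls k ⟨n, G', w⟩)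
  | arnold {n : ℕ} (G₁ G₂ G₃ : OrientedTree (Fin n)) (w : Fin n → Σ d, W d)
      (h : OrientedTree.ArnoldTriple G₁ G₂ G₃) :
      ArnRel (cls k ⟨n, G₁, w⟩ + cls k ⟨n, G₂, w⟩ + cls k ⟨n, G₃, w⟩)

/-- The subspace generated by the arrow-reversing and Arnold expressions. -/
noncomputable def arn : Submodule k (GraphSpace k W) := Submodule.span k {z | ArnRel k W z}

/-- The space underlying the Lie coalgebra on `W`: the quotient of the graph coalgebra by the
arrow-reversing and Arnold relations. -/
abbrev LieSpace : Type _ := GraphSpace k W ⧸ arn k W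

/-- The weight `n` part of the Lie coalgebra. -/
noncomputable def lieWeight (n : ℕ) : Submodule k (LieSpace k W) :=
  (graphWeight k W n).map (arn k W).mkQ

variable {W} in
open Classical in
/-- The anti-commutative graph cobracket of a labelled tree: the sum over the edges, pointing from
the part `x₁` to the part `x₂`, of `± x₁ ⊗ x₂ - ± x₂ ⊗ x₁`, with Koszul signs for the reordering of
the labels. -/
noncomputable def treeCobracket (x : LabeledTree W) : GraphSpace k W ⊗[k] GraphSpace k W :=
  ∑ e : x.graph.Edge,
    (unshuffleSign x.deg (x.graph.srcSide e) (x.graph.tgtSide e) •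
        (cls k (x.srcPart e) ⊗ₜ[k] cls k (x.tgtPart e)) -
      unshuffleSign x.deg (x.graph.tgtSide e) (x.graph.srcSide e) •
        (cls k (x.tgtPart e) ⊗ₜ[k] cls k (x.srcPart e)))

/-! Auxiliary facts: the cobracket written as a sum over vertex subsets, from which it follows
that it is compatible with all relations. -/

/-- Exactly one arrow of `r` joins `S` and its complement, and it leaves `S`. -/
def IsCut {n : ℕ} (r : Fin n → Fin n → Prop) (S : Finset (Fin n)) : Prop :=
  ∃ a b, r a b ∧ a ∈ S ∧ b ∉ S ∧ ∀ i j, r i j → (i ∈ S ↔ j ∈ S) ∨ (i = a ∧ j = b)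

theorem srcSide_eq {n : ℕ} (G : OrientedTree (Fin n)) (e : G.Edge) (S : Finset (Fin n))
    (ha : e.1.1 ∈ S) (hb : e.1.2 ∉ S)
    (h : ∀ i j, G.arrow i j → (i ∈ S ↔ j ∈ S) ∨ (i = e.1.1 ∧ j = e.1.2)) : G.srcSide e = S := by
  have step : ∀ i j, (G.cut e).Adj i j → (i ∈ S ↔ j ∈ S) := by
    intro i j hij
    obtain ⟨h1, h2⟩ := (G.cut_adj e).1 hij
    rcases h1 with h1 | h1
    · rcases h i j h1 with h3 | h3
      · exact h3
      · exact absurd (Or.inl h3) h2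
    · rcases h j i h1 with h3 | h3
      · exact h3.symm
      · exact absurd (Or.inr ⟨h3.2, h3.1⟩) h2
  have reach : ∀ i j, (G.cut e).Reachable i j → (i ∈ S ↔ j ∈ S) := by
    intro i j hij
    rw [SimpleGraph.reachable_iff_reflTransGen] at hij
    induction hij with
    | refl => exact Iff.rfl
    | tail _ hxy ih => exact ih.trans (step _ _ hxy)
  ext v
  rw [OrientedTree.mem_srcSide]
  constructor
  · intro hv
    exact (reach _ _ hv).1 ha
  · intro hv
    rcases G.reachable_cut e v with h1 | h1
    · exact h1
    · exact absurd ((reach _ _ h1).2 hv) hb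

theorem srcSide_spec {n : ℕ} (G : OrientedTree (Fin n)) (e : G.Edge) :
    e.1.1 ∈ G.srcSide e ∧ e.1.2 ∉ G.srcSide e ∧
      ∀ i j, G.arrow i j → (i ∈ G.srcSide e ↔ j ∈ G.srcSide e) ∨ (i = e.1.1 ∧ j = e.1.2) := by
  simp only [OrientedTree.mem_srcSide]
  refine ⟨SimpleGraph.Reachable.refl _, G.not_reachable_cut e, ?_⟩
  intro i j hij
  by_cases h : (i = e.1.1 ∧ j = e.1.2) ∨ (i = e.1.2 ∧ j = e.1.1)
  · rcases h with h | h
    · exact Or.inr h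
    · refine absurd e.2 (G.isOrientedTree.1 _ _ ?_)
      rw [← h.1, ← h.2]
      exact hij
  · have hadj : (G.cut e).Adj i j := (G.cut_adj e).2 ⟨Or.inl hij, h⟩
    exact Or.inl ⟨fun h => h.trans hadj.reachable, fun h => h.trans hadj.symm.reachable⟩

theorem isCut_srcSide {n : ℕ} (G : OrientedTree (Fin n)) (e : G.Edge) :
    IsCut G.arrow (G.srcSide e) :=
  ⟨e.1.1, e.1.2, e.2, srcSide_spec G e⟩

theorem exists_srcSide_eq {n : ℕ} (G : OrientedTree (Fin n)) (S : Finset (Fin n))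
    (h : IsCut G.arrow S) : ∃ e : G.Edge, G.srcSide e = S := by
  obtain ⟨a, b, hab, ha, hb, h⟩ := h
  exact ⟨⟨(a, b), hab⟩, srcSide_eq G ⟨(a, b), hab⟩ S ha hb h⟩

theorem srcSide_injective {n : ℕ} (G : OrientedTree (Fin n)) :
    Function.Injective fun e : G.Edge => G.srcSide e := by
  intro e e' h
  have h1 := srcSide_spec G e
  have h2 := srcSide_spec G e'
  have h' : G.srcSide e = G.srcSide e' := h
  rcases h2.2.2 _ _ e.2 with h3 | h3
  · rw [← h'] at h3
    exact absurd (h3.1 h1.1) h1.2.1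
  · exact Subtype.ext (Prod.ext h3.1 h3.2)

open Classical in
theorem sum_edges {n : ℕ} {M : Type*} [AddCommGroup M] (G : OrientedTree (Fin n))
    (f : Finset (Fin n) → M) :
    ∑ e : G.Edge, f (G.srcSide e) = ∑ S, if IsCut G.arrow S then f S else 0 := by
  rw [← Finset.sum_filter]
  refine Finset.sum_bij (fun e _ => G.srcSide e) ?_ ?_ ?_ ?_
  · intro e _
    exact Finset.mem_filter.2 ⟨Finset.mem_univ _, isCut_srcSide G e⟩
  · intro e _ e' _ h
    exact srcSide_injective G h
  · intro S hS
    obtain ⟨e, he⟩ := exists_srcSide_eq G S (Finset.mem_filter.1 hS).2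
    exact ⟨e, Finset.mem_univ _, he⟩
  · intro e _
    rfl

variable {W} in
open Classical in
/-- The class of a labelled graph if the graph is a tree, and zero otherwise. -/
noncomputable def clsRaw {n : ℕ} (r : Fin n → Fin n → Prop) (w : Fin n → Σ d, W d) :
    GraphSpace k W :=
  if h : IsOrientedTree r then cls k ⟨n, ⟨r, h⟩, w⟩ else 0

variable {W} in
/-- `clsRaw` of the restriction to a subset. -/
noncomputable def clsOn {n : ℕ} (r : Fin n → Fin n → Prop) (w : Fin n → Σ d, W d)
    (S : Finset (Fin n)) : GraphSpace k W :=
  clsRaw k (fun i j : Fin S.card => r (S.orderEmbOfFin rfl i) (S.orderEmbOfFin rfl j))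
    (fun i => w (S.orderEmbOfFin rfl i))

variable {W} in
/-- One summand of the cobracket. -/
noncomputable def cutTerm {n : ℕ} (r : Fin n → Fin n → Prop) (w : Fin n → Σ d, W d)
    (S : Finset (Fin n)) : GraphSpace k W ⊗[k] GraphSpace k W :=
  unshuffleSign (fun i => (w i).1) S Sᶜ • (clsOn k r w S ⊗ₜ[k] clsOn k r w Sᶜ)

variable {W} in
theorem cls_restrict {n : ℕ} (G : OrientedTree (Fin n)) (w : Fin n → Σ d, W d)
    (S : Finset (Fin n)) (hS : (G.toSimple.induce (S : Set (Fin n))).Connected) :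
    cls k (LabeledTree.restrict ⟨n, G, w⟩ S hS) = clsOn k G.arrow w S := by
  have h : IsOrientedTree
      (fun i j : Fin S.card => G.arrow (S.orderEmbOfFin rfl i) (S.orderEmbOfFin rfl j)) :=
    (G.restrict S hS).isOrientedTree
  unfold clsOn clsRaw
  rw [dif_pos h]
  rfl

variable {W} in
open Classical in
theorem treeCobracket_eq {n : ℕ} (G : OrientedTree (Fin n)) (w : Fin n → Σ d, W d) :
    treeCobracket k ⟨n, G, w⟩ =
      ∑ S, if IsCut G.arrow S then cutTerm k G.arrow w S - cutTerm k G.arrow w Sᶜ else 0 := by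
  rw [← sum_edges G (fun S => cutTerm k G.arrow w S - cutTerm k G.arrow w Sᶜ)]
  unfold treeCobracket
  refine Finset.sum_congr rfl fun e _ => ?_
  have h1 : cls k (LabeledTree.srcPart ⟨n, G, w⟩ e) = clsOn k G.arrow w (G.srcSide e) :=
    cls_restrict k G w _ _
  have h2 : cls k (LabeledTree.tgtPart ⟨n, G, w⟩ e) = clsOn k G.arrow w (G.srcSide e)ᶜ := by
    rw [← G.tgtSide_eq_compl e]
    exact cls_restrict k G w _ _
  rw [h1, h2]
  have h3 : G.tgtSide e = (G.srcSide e)ᶜ := G.tgtSide_eq_compl e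
  simp only [cutTerm, compl_compl]
  change unshuffleSign _ (G.srcSide e) (G.tgtSide e) • _ -
    unshuffleSign _ (G.tgtSide e) (G.srcSide e) • _ = _
  rw [h3]
  rfl

variable {W} in
theorem cls_add {n : ℕ} (G : OrientedTree (Fin n)) (w : Fin n → Σ d, W d) (i : Fin n) (d : ℤ)
    (a b : W d) : cls k ⟨n, G, Function.update w i ⟨d, a + b⟩⟩ =
      cls k ⟨n, G, Function.update w i ⟨d, a⟩⟩ + cls k ⟨n, G, Function.update w i ⟨d, b⟩⟩ := by
  have h := (Submodule.Quotient.mk_eq_zero (Submodule.span k {z | GraphRel k W z})).2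
    (Submodule.subset_span (GraphRel.add (k := k) G w i d a b))
  rw [Submodule.Quotient.mk_sub, Submodule.Quotient.mk_sub] at h
  rw [sub_sub, sub_eq_zero] at h
  exact h

variable {W} in
theorem cls_smul {n : ℕ} (G : OrientedTree (Fin n)) (w : Fin n → Σ d, W d) (i : Fin n) (d : ℤ)
    (c : k) (a : W d) : cls k ⟨n, G, Function.update w i ⟨d, c • a⟩⟩ =
      c • cls k ⟨n, G, Function.update w i ⟨d, a⟩⟩ := by
  have h := (Submodule.Quotient.mk_eq_zero (Submodule.span k {z | GraphRel k W z})).2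
    (Submodule.subset_span (GraphRel.smul (k := k) G w i d c a))
  rw [Submodule.Quotient.mk_sub, Submodule.Quotient.mk_smul, sub_eq_zero] at h
  exact h

variable {W} in
theorem cls_perm (x y : LabeledTree W) (σ : Fin x.size ≃ Fin y.size)
    (harrow : ∀ i j, x.graph.arrow i j ↔ y.graph.arrow (σ i) (σ j))
    (hlabel : ∀ i, x.label i = y.label (σ i)) :
    cls k x = koszulSign x.deg σ • cls k y := by
  have h := (Submodule.Quotient.mk_eq_zero (Submodule.span k {z | GraphRel k W z})).2
    (Submodule.subset_span (GraphRel.perm (k := k) x y σ harrow hlabel))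
  rw [Submodule.Quotient.mk_sub, sub_eq_zero] at h
  refine h.trans ?_
  rw [Units.smul_def, Units.smul_def]
  exact map_zsmul (Submodule.mkQ _) _ _

variable {W} in
/-- The labels on a subset after changing one label. -/
theorem update_orderEmb {n : ℕ} (w : Fin n → Σ d, W d) (i : Fin n) (z : Σ d, W d)
    (S : Finset (Fin n)) :
    (i ∉ S → (fun j => Function.update w i z (S.orderEmbOfFin rfl j)) =
      fun j => w (S.orderEmbOfFin rfl j)) ∧
    ∀ i', S.orderEmbOfFin rfl i' = i →
      (fun j => Function.update w i z (S.orderEmbOfFin rfl j)) =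
        Function.update (fun j => w (S.orderEmbOfFin rfl j)) i' z := by
  constructor
  · intro hi
    funext j
    have : S.orderEmbOfFin rfl j ≠ i := fun h => hi (h ▸ S.orderEmbOfFin_mem rfl j)
    rw [Function.update_of_ne this]
  · rintro i' rfl
    funext j
    by_cases h : j = i'
    · subst h
      simp
    · have : S.orderEmbOfFin rfl j ≠ S.orderEmbOfFin rfl i' :=
        fun h' => h ((S.orderEmbOfFin rfl).injective h')
      rw [Function.update_of_ne this, Function.update_of_ne h]

theorem exists_orderEmb {n : ℕ} (S : Finset (Fin n)) (i : Fin n) (hi : i ∈ S) :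
    ∃ i', S.orderEmbOfFin rfl i' = i := by
  have h := S.range_orderEmbOfFin rfl
  have h' : i ∈ Set.range (S.orderEmbOfFin rfl) := by rw [h]; exact hi
  exact h'

variable {W} in
theorem clsOn_notMem {n : ℕ} (r : Fin n → Fin n → Prop) (w : Fin n → Σ d, W d)
    (S : Finset (Fin n)) (i : Fin n) (hi : i ∉ S) (z : Σ d, W d) :
    clsOn k r (Function.update w i z) S = clsOn k r w S := by
  unfold clsOn
  rw [(update_orderEmb w i z S).1 hi]

variable {W} in
theorem clsOn_add {n : ℕ} (r : Fin n → Fin n → Prop) (w : Fin n → Σ d, W d)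
    (S : Finset (Fin n)) (i : Fin n) (hi : i ∈ S) (d : ℤ) (a b : W d) :
    clsOn k r (Function.update w i ⟨d, a + b⟩) S =
      clsOn k r (Function.update w i ⟨d, a⟩) S + clsOn k r (Function.update w i ⟨d, b⟩) S := by
  obtain ⟨i', hi'⟩ := exists_orderEmb S i hi
  unfold clsOn
  rw [(update_orderEmb w i _ S).2 i' hi', (update_orderEmb w i _ S).2 i' hi',
    (update_orderEmb w i _ S).2 i' hi']
  unfold clsRaw
  split_ifs
  · exact cls_add k _ _ _ _ _ _
  · rw [add_zero]

variable {W} in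
theorem clsOn_smul {n : ℕ} (r : Fin n → Fin n → Prop) (w : Fin n → Σ d, W d)
    (S : Finset (Fin n)) (i : Fin n) (hi : i ∈ S) (d : ℤ) (c : k) (a : W d) :
    clsOn k r (Function.update w i ⟨d, c • a⟩) S =
      c • clsOn k r (Function.update w i ⟨d, a⟩) S := by
  obtain ⟨i', hi'⟩ := exists_orderEmb S i hi
  unfold clsOn
  rw [(update_orderEmb w i _ S).2 i' hi', (update_orderEmb w i _ S).2 i' hi']
  unfold clsRaw
  split_ifs
  · exact cls_smul k _ _ _ _ _ _
  · rw [smul_zero]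

variable {W} in
theorem deg_update {n : ℕ} (w : Fin n → Σ d, W d) (i : Fin n) (d : ℤ) (a b : W d) :
    (fun j => (Function.update w i ⟨d, a⟩ j).1) = fun j => (Function.update w i ⟨d, b⟩ j).1 := by
  funext j
  by_cases h : j = i
  · subst h; simp
  · rw [Function.update_of_ne h, Function.update_of_ne h]

variable {W} in
theorem cutTerm_add {n : ℕ} (r : Fin n → Fin n → Prop) (w : Fin n → Σ d, W d)
    (S : Finset (Fin n)) (i : Fin n) (d : ℤ) (a b : W d) :
    cutTerm k r (Function.update w i ⟨d, a + b⟩) S =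
      cutTerm k r (Function.update w i ⟨d, a⟩) S + cutTerm k r (Function.update w i ⟨d, b⟩) S := by
  unfold cutTerm
  rw [deg_update w i d (a + b) a, deg_update w i d b a, ← smul_add]
  congr 1
  by_cases hi : i ∈ S
  · have hi' : i ∉ Sᶜ := by simpa using hi
    rw [clsOn_add k r w S i hi, clsOn_notMem k r w _ i hi', clsOn_notMem k r w _ i hi',
      clsOn_notMem k r w _ i hi', TensorProduct.add_tmul]
  · have hi' : i ∈ Sᶜ := by simpa using hi
    rw [clsOn_add k r w _ i hi', clsOn_notMem k r w _ i hi, clsOn_notMem k r w _ i hi,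
      clsOn_notMem k r w _ i hi, TensorProduct.tmul_add]

variable {W} in
theorem cutTerm_smul {n : ℕ} (r : Fin n → Fin n → Prop) (w : Fin n → Σ d, W d)
    (S : Finset (Fin n)) (i : Fin n) (d : ℤ) (c : k) (a : W d) :
    cutTerm k r (Function.update w i ⟨d, c • a⟩) S =
      c • cutTerm k r (Function.update w i ⟨d, a⟩) S := by
  unfold cutTerm
  rw [deg_update w i d (c • a) a, Units.smul_def, Units.smul_def, smul_comm c]
  congr 1
  by_cases hi : i ∈ S
  · have hi' : i ∉ Sᶜ := by simpa using hi
    rw [clsOn_smul k r w S i hi, clsOn_notMem k r w _ i hi', clsOn_notMem k r w _ i hi',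
      TensorProduct.smul_tmul']
  · have hi' : i ∈ Sᶜ := by simpa using hi
    rw [clsOn_smul k r w _ i hi', clsOn_notMem k r w _ i hi, clsOn_notMem k r w _ i hi,
      TensorProduct.tmul_smul]

theorem treeCobracket_add {n : ℕ} (G : OrientedTree (Fin n)) (w : Fin n → Σ d, W d) (i : Fin n)
    (d : ℤ) (a b : W d) : treeCobracket k ⟨n, G, Function.update w i ⟨d, a + b⟩⟩ =
      treeCobracket k ⟨n, G, Function.update w i ⟨d, a⟩⟩ +
        treeCobracket k ⟨n, G, Function.update w i ⟨d, b⟩⟩ := by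
  classical
  rw [treeCobracket_eq, treeCobracket_eq, treeCobracket_eq, ← Finset.sum_add_distrib]
  refine Finset.sum_congr rfl fun S _ => ?_
  split_ifs
  · rw [cutTerm_add, cutTerm_add]
    abel
  · rw [add_zero]

theorem treeCobracket_smul {n : ℕ} (G : OrientedTree (Fin n)) (w : Fin n → Σ d, W d) (i : Fin n)
    (d : ℤ) (c : k) (a : W d) : treeCobracket k ⟨n, G, Function.update w i ⟨d, c • a⟩⟩ =
      c • treeCobracket k ⟨n, G, Function.update w i ⟨d, a⟩⟩ := by
  classical
  rw [treeCobracket_eq, treeCobracket_eq, Finset.smul_sum]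
  refine Finset.sum_congr rfl fun S _ => ?_
  split_ifs
  · rw [cutTerm_smul, cutTerm_smul, smul_sub]
  · rw [smul_zero]

/-- The renumbering of the vertices of a subset induced by a renumbering of all vertices. -/
noncomputable def subEquiv {n m : ℕ} (σ : Fin n ≃ Fin m) (S : Finset (Fin n))
    (T : Finset (Fin m)) (h : ∀ i, i ∈ S ↔ σ i ∈ T) : Fin S.card ≃ Fin T.card :=
  (S.orderIsoOfFin rfl).toEquiv.trans ((σ.subtypeEquiv h).trans (T.orderIsoOfFin rfl).toEquiv.symm)

theorem subEquiv_apply {n m : ℕ} (σ : Fin n ≃ Fin m) (S : Finset (Fin n))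
    (T : Finset (Fin m)) (h : ∀ i, i ∈ S ↔ σ i ∈ T) (i : Fin S.card) :
    T.orderEmbOfFin rfl (subEquiv σ S T h i) = σ (S.orderEmbOfFin rfl i) := by
  unfold subEquiv
  rw [← Finset.coe_orderIsoOfFin_apply, ← Finset.coe_orderIsoOfFin_apply]
  simp

theorem prod_orderEmb {n : ℕ} {M : Type*} [CommMonoid M] (S : Finset (Fin n)) (f : Fin n → M) :
    ∏ i : Fin S.card, f (S.orderEmbOfFin rfl i) = ∏ i ∈ S, f i := by
  conv_rhs => rw [← S.map_orderEmbOfFin_univ rfl]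
  rw [Finset.prod_map]
  rfl

theorem koszulSign_subEquiv {n m : ℕ} (d : Fin n → ℤ) (σ : Fin n ≃ Fin m) (S : Finset (Fin n))
    (T : Finset (Fin m)) (h : ∀ i, i ∈ S ↔ σ i ∈ T) :
    koszulSign (fun i => d (S.orderEmbOfFin rfl i)) (subEquiv σ S T h) =
      ∏ i ∈ S, ∏ j ∈ S, if i < j ∧ σ j < σ i then (d i * d j).negOnePow else 1 := by
  unfold koszulSign
  rw [← prod_orderEmb S (fun i => ∏ j ∈ S, if i < j ∧ σ j < σ i then (d i * d j).negOnePow else 1)]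
  refine Finset.prod_congr rfl fun i _ => ?_
  rw [← prod_orderEmb S (fun j => if S.orderEmbOfFin rfl i < j ∧ σ j < σ (S.orderEmbOfFin rfl i)
    then (d (S.orderEmbOfFin rfl i) * d j).negOnePow else 1)]
  refine Finset.prod_congr rfl fun j _ => ?_
  have h1 : ∀ a b, a < b ↔ S.orderEmbOfFin rfl a < S.orderEmbOfFin rfl b :=
    fun a b => (S.orderEmbOfFin rfl).lt_iff_lt.symm
  have h2 : ∀ a b, a < b ↔ T.orderEmbOfFin rfl a < T.orderEmbOfFin rfl b :=
    fun a b => (T.orderEmbOfFin rfl).lt_iff_lt.symm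
  simp only [h1 i j, h2, subEquiv_apply]

theorem mem_map_equiv' {n m : ℕ} (σ : Fin n ≃ Fin m) (S : Finset (Fin n)) (i : Fin n) :
    i ∈ S ↔ σ i ∈ S.map σ.toEmbedding := by
  simp

theorem mem_compl_map {n m : ℕ} (σ : Fin n ≃ Fin m) (S : Finset (Fin n)) (i : Fin n) :
    i ∈ Sᶜ ↔ σ i ∈ (S.map σ.toEmbedding)ᶜ := by
  simp

theorem sign_identity {n m : ℕ} (d : Fin n → ℤ) (d' : Fin m → ℤ) (σ : Fin n ≃ Fin m)
    (hd : ∀ i, d i = d' (σ i)) (S : Finset (Fin n)) :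
    unshuffleSign d S Sᶜ *
      ((∏ i ∈ S, ∏ j ∈ S, if i < j ∧ σ j < σ i then (d i * d j).negOnePow else 1) *
       (∏ i ∈ Sᶜ, ∏ j ∈ Sᶜ, if i < j ∧ σ j < σ i then (d i * d j).negOnePow else 1)) =
      koszulSign d σ * unshuffleSign d' (S.map σ.toEmbedding) (S.map σ.toEmbedding)ᶜ := by
  have hc : (S.map σ.toEmbedding)ᶜ = Sᶜ.map σ.toEmbedding := by
    ext j
    obtain ⟨i, rfl⟩ := σ.surjective j
    rw [← mem_compl_map, ← mem_map_equiv']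
  have h1 : unshuffleSign d' (S.map σ.toEmbedding) (S.map σ.toEmbedding)ᶜ =
      ∏ i ∈ S, ∏ j ∈ Sᶜ, if σ j < σ i then (d i * d j).negOnePow else 1 := by
    unfold unshuffleSign
    rw [hc]
    simp only [Finset.prod_map, Equiv.coe_toEmbedding, hd]
  have split : ∀ f : Fin n → Fin n → ℤˣ, ∏ i, ∏ j, f i j =
      ((∏ i ∈ S, ∏ j ∈ S, f i j) * (∏ i ∈ Sᶜ, ∏ j ∈ Sᶜ, f i j)) *
        ∏ i ∈ S, ∏ j ∈ Sᶜ, (f i j * f j i) := by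
    intro f
    have e1 : ∀ i, ∏ j, f i j = (∏ j ∈ S, f i j) * ∏ j ∈ Sᶜ, f i j :=
      fun i => (Finset.prod_mul_prod_compl S _).symm
    rw [← Finset.prod_mul_prod_compl S (fun i => ∏ j, f i j)]
    simp only [e1, Finset.prod_mul_distrib]
    rw [Finset.prod_comm (s := Sᶜ) (t := S)]
    ac_rfl
  have h2 : koszulSign d σ = _ := split _
  rw [h1, h2, mul_comm (unshuffleSign d S Sᶜ)]
  refine Eq.trans ?_ (mul_assoc _ _ _).symm
  congr 1
  unfold unshuffleSign
  rw [← Finset.prod_mul_distrib]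
  refine Finset.prod_congr rfl fun i hi => ?_
  rw [← Finset.prod_mul_distrib]
  refine Finset.prod_congr rfl fun j hj => ?_
  have hne : i ≠ j := by
    rintro rfl
    exact (Finset.mem_compl.1 hj) hi
  have hne' : σ i ≠ σ j := fun h => hne (σ.injective h)
  rw [mul_comm (d j) (d i)]
  have hsq : (d i * d j).negOnePow * (d i * d j).negOnePow = 1 := Int.units_mul_self _
  rcases lt_or_gt_of_ne hne with h | h <;> rcases lt_or_gt_of_ne hne' with h' | h' <;>
    simp [h, h', h.not_gt, h'.not_gt, hsq]

theorem isOrientedTree_of_equiv {V V' : Type*} (r : V → V → Prop) (r' : V' → V' → Prop)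
    (σ : V ≃ V') (hr : ∀ i j, r i j ↔ r' (σ i) (σ j)) (h : IsOrientedTree r') :
    IsOrientedTree r := by
  refine ⟨fun a b h1 h2 => h.1 _ _ ((hr a b).1 h1) ((hr b a).1 h2), ?_⟩
  have heq : SimpleGraph.fromRel r = (SimpleGraph.fromRel r').comap σ := by
    ext i j
    simp [SimpleGraph.fromRel_adj, SimpleGraph.comap_adj, hr]
  rw [heq]
  refine ⟨(SimpleGraph.Iso.comap σ _).connected_iff.2 h.2.1, h.2.2.of_comap σ.toEmbedding⟩

variable {W} in
theorem clsRaw_perm {n m : ℕ} (r : Fin n → Fin n → Prop) (r' : Fin m → Fin m → Prop)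
    (w : Fin n → Σ d, W d) (w' : Fin m → Σ d, W d) (σ : Fin n ≃ Fin m)
    (hr : ∀ i j, r i j ↔ r' (σ i) (σ j)) (hw : ∀ i, w i = w' (σ i)) :
    clsRaw k r w = koszulSign (fun i => (w i).1) σ • clsRaw k r' w' := by
  unfold clsRaw
  by_cases h : IsOrientedTree r'
  · have h' := isOrientedTree_of_equiv r r' σ hr h
    rw [dif_pos h, dif_pos h']
    exact cls_perm k ⟨n, ⟨r, h'⟩, w⟩ ⟨m, ⟨r', h⟩, w'⟩ σ hr hw
  · have h' : ¬ IsOrientedTree r := fun h1 =>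
      h (isOrientedTree_of_equiv r' r σ.symm (fun i j => by simp [hr]) h1)
    rw [dif_neg h, dif_neg h', smul_zero]

variable {W} in
theorem clsOn_perm {n m : ℕ} (r : Fin n → Fin n → Prop) (r' : Fin m → Fin m → Prop)
    (w : Fin n → Σ d, W d) (w' : Fin m → Σ d, W d) (σ : Fin n ≃ Fin m)
    (hr : ∀ i j, r i j ↔ r' (σ i) (σ j)) (hw : ∀ i, w i = w' (σ i)) (S : Finset (Fin n))
    (T : Finset (Fin m)) (h : ∀ i, i ∈ S ↔ σ i ∈ T) :
    clsOn k r w S = (∏ i ∈ S, ∏ j ∈ S,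
      if i < j ∧ σ j < σ i then ((w i).1 * (w j).1).negOnePow else 1) • clsOn k r' w' T := by
  rw [← koszulSign_subEquiv (fun i => (w i).1) σ S T h]
  unfold clsOn
  refine clsRaw_perm k _ _ _ _ (subEquiv σ S T h) ?_ ?_
  · intro i j
    rw [subEquiv_apply, subEquiv_apply]
    exact hr _ _
  · intro i
    rw [subEquiv_apply]
    exact hw _

theorem smul_tmul_units {A B : Type*} [AddCommGroup A] [AddCommGroup B] [Module k A] [Module k B]
    (u v s : ℤˣ) (a : A) (b : B) :
    u • ((v • a) ⊗ₜ[k] (s • b)) = (u * (v * s)) • (a ⊗ₜ[k] b) := by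
  rcases Int.units_eq_one_or v with rfl | rfl <;> rcases Int.units_eq_one_or s with rfl | rfl <;>
    simp [Units.smul_def, TensorProduct.neg_tmul, TensorProduct.tmul_neg]

variable {W} in
theorem cutTerm_perm {n m : ℕ} (r : Fin n → Fin n → Prop) (r' : Fin m → Fin m → Prop)
    (w : Fin n → Σ d, W d) (w' : Fin m → Σ d, W d) (σ : Fin n ≃ Fin m)
    (hr : ∀ i j, r i j ↔ r' (σ i) (σ j)) (hw : ∀ i, w i = w' (σ i)) (S : Finset (Fin n)) :
    cutTerm k r w S = koszulSign (fun i => (w i).1) σ • cutTerm k r' w' (S.map σ.toEmbedding) := by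
  unfold cutTerm
  rw [clsOn_perm k r r' w w' σ hr hw S _ (mem_map_equiv' σ S),
    clsOn_perm k r r' w w' σ hr hw Sᶜ _ (mem_compl_map σ S), smul_tmul_units,
    sign_identity (fun i => (w i).1) (fun i => (w' i).1) σ (fun i => by rw [hw]) S, mul_smul]

theorem isCut_perm {n m : ℕ} (r : Fin n → Fin n → Prop) (r' : Fin m → Fin m → Prop)
    (σ : Fin n ≃ Fin m) (hr : ∀ i j, r i j ↔ r' (σ i) (σ j)) (S : Finset (Fin n)) :
    IsCut r S ↔ IsCut r' (S.map σ.toEmbedding) := by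
  unfold IsCut
  refine σ.exists_congr fun a => σ.exists_congr fun b => ?_
  rw [← mem_map_equiv' σ S, ← mem_map_equiv' σ S, hr]
  refine and_congr_right fun _ => and_congr_right fun _ => and_congr_right fun _ => ?_
  refine σ.forall_congr fun i => σ.forall_congr fun j => ?_
  rw [← mem_map_equiv' σ S, ← mem_map_equiv' σ S, hr, σ.apply_eq_iff_eq, σ.apply_eq_iff_eq]

theorem treeCobracket_perm (x y : LabeledTree W) (σ : Fin x.size ≃ Fin y.size)
    (harrow : ∀ i j, x.graph.arrow i j ↔ y.graph.arrow (σ i) (σ j))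
    (hlabel : ∀ i, x.label i = y.label (σ i)) :
    treeCobracket k x = koszulSign x.deg σ • treeCobracket k y := by
  classical
  obtain ⟨n, G, w⟩ := x
  obtain ⟨m, G', w'⟩ := y
  rw [treeCobracket_eq, treeCobracket_eq, Finset.smul_sum]
  refine Fintype.sum_equiv σ.finsetCongr _ _ fun S => ?_
  rw [Equiv.finsetCongr_apply]
  have h1 := isCut_perm G.arrow G'.arrow σ harrow S
  have hc : Sᶜ.map σ.toEmbedding = (S.map σ.toEmbedding)ᶜ := by
    ext j
    obtain ⟨i, rfl⟩ := σ.surjective j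
    rw [← mem_compl_map, ← mem_map_equiv']
  by_cases h : IsCut G.arrow S
  · rw [if_pos h, if_pos (h1.1 h), smul_sub, ← hc]
    rw [cutTerm_perm k G.arrow G'.arrow w w' σ harrow hlabel S,
      cutTerm_perm k G.arrow G'.arrow w w' σ harrow hlabel Sᶜ]
    rfl
  · rw [if_neg h, if_neg (fun h' => h (h1.2 h')), smul_zero]

theorem graphRel_le_ker : Submodule.span k {z | GraphRel k W z} ≤
    LinearMap.ker (Finsupp.linearCombination k (treeCobracket (W := W) k)) := by
  rw [Submodule.span_le]
  rintro z (⟨G, w, i, d, a, b⟩ | ⟨G, w, i, d, c, a⟩ | ⟨x, y, σ, harrow, hlabel⟩)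
  · rw [SetLike.mem_coe, LinearMap.mem_ker]
    simp only [map_sub, Finsupp.linearCombination_single, one_smul]
    rw [treeCobracket_add]
    abel
  · rw [SetLike.mem_coe, LinearMap.mem_ker]
    simp only [map_sub, map_smul, Finsupp.linearCombination_single, one_smul]
    rw [treeCobracket_smul, sub_self]
  · rw [SetLike.mem_coe, LinearMap.mem_ker, Units.smul_def, map_sub, map_zsmul]
    simp only [Finsupp.linearCombination_single, one_smul]
    rw [treeCobracket_perm k W x y σ harrow hlabel, Units.smul_def, sub_self]

/-- The anti-commutative graph cobracket. -/
noncomputable def graphCobracket : GraphSpace k W →ₗ[k] GraphSpace k W ⊗[k] GraphSpace k W :=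
  (Submodule.span k {z | GraphRel k W z}).liftQ
    (Finsupp.linearCombination k (treeCobracket k)) (graphRel_le_ker k W)

variable {W} in
theorem graphCobracket_cls (x : LabeledTree W) :
    graphCobracket k W (cls k x) = treeCobracket k x := by
  have h : graphCobracket k W (cls k x) =
      Finsupp.linearCombination k (treeCobracket (W := W) k) (Finsupp.single x 1) := rfl
  rw [h, Finsupp.linearCombination_single, one_smul]

variable {W} in
/-- One summand of the cobracket, in the quotient. -/
noncomputable def lieTerm {n : ℕ} (r : Fin n → Fin n → Prop) (w : Fin n → Σ d, W d)
    (S : Finset (Fin n)) : LieSpace k W ⊗[k] LieSpace k W :=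
  TensorProduct.map (arn k W).mkQ (arn k W).mkQ (cutTerm k r w S)

variable {W} in
theorem lieTerm_eq {n : ℕ} (r : Fin n → Fin n → Prop) (w : Fin n → Σ d, W d)
    (S : Finset (Fin n)) : lieTerm k r w S =
      unshuffleSign (fun i => (w i).1) S Sᶜ •
        ((arn k W).mkQ (clsOn k r w S) ⊗ₜ[k] (arn k W).mkQ (clsOn k r w Sᶜ)) := by
  unfold lieTerm cutTerm
  rw [Units.smul_def, Units.smul_def, map_zsmul, TensorProduct.map_tmul]

variable {W} in
open Classical in
/-- All contributions of the pair `(S, Sᶜ)` to the cobracket in the quotient. -/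
noncomputable def lieContrib {n : ℕ} (r : Fin n → Fin n → Prop) (w : Fin n → Σ d, W d)
    (S : Finset (Fin n)) : LieSpace k W ⊗[k] LieSpace k W :=
  (if IsCut r S then lieTerm k r w S else 0) - (if IsCut r Sᶜ then lieTerm k r w S else 0)

variable {W} in
theorem map_treeCobracket {n : ℕ} (G : OrientedTree (Fin n)) (w : Fin n → Σ d, W d) :
    TensorProduct.map (arn k W).mkQ (arn k W).mkQ (graphCobracket k W (cls k ⟨n, G, w⟩)) =
      ∑ S, lieContrib k G.arrow w S := by
  classical
  rw [graphCobracket_cls, treeCobracket_eq, map_sum]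
  unfold lieContrib
  rw [Finset.sum_sub_distrib]
  have h : ∑ S, (if IsCut G.arrow Sᶜ then lieTerm k G.arrow w S else 0) =
      ∑ S, (if IsCut G.arrow S then lieTerm k G.arrow w Sᶜ else 0) := by
    refine Fintype.sum_equiv (compl_involutive.toPerm _) _ _ fun S => ?_
    simp [Function.Involutive.coe_toPerm]
  rw [h, ← Finset.sum_sub_distrib]
  refine Finset.sum_congr rfl fun S _ => ?_
  split_ifs
  · rw [map_sub]
    rfl
  · rw [map_zero, sub_zero]

theorem isCut_congr {n : ℕ} {r r' : Fin n → Fin n → Prop} {S : Finset (Fin n)}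
    (h : ∀ i j, ¬ (i ∈ S ↔ j ∈ S) → (r i j ↔ r' i j)) : IsCut r S ↔ IsCut r' S := by
  have key : ∀ r r' : Fin n → Fin n → Prop,
      (∀ i j, ¬ (i ∈ S ↔ j ∈ S) → (r i j ↔ r' i j)) → IsCut r S → IsCut r' S := by
    rintro r r' h ⟨a, b, hab, ha, hb, hu⟩
    refine ⟨a, b, (h a b fun h' => hb (h'.1 ha)).1 hab, ha, hb, fun i j hij => ?_⟩
    by_cases hc : i ∈ S ↔ j ∈ S
    · exact Or.inl hc
    · exact hu i j ((h i j hc).2 hij)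
  exact ⟨key r r' h, key r' r fun i j hij => (h i j hij).symm⟩

theorem isCut_iff {n : ℕ} {r r' : Fin n → Fin n → Prop} {S : Finset (Fin n)} {p q : Fin n}
    (hp : p ∈ S) (hq : q ∉ S) (hpq : ¬ r p q)
    (h : ∀ i j, ¬ (i ∈ S ↔ j ∈ S) → (r' i j ↔ r i j ∨ (i = p ∧ j = q))) :
    (IsCut r' S ↔ ∀ i j, r i j → (i ∈ S ↔ j ∈ S)) ∧ ¬ IsCut r' Sᶜ := by
  have hpq' : r' p q := (h p q fun h' => hq (h'.1 hp)).2 (Or.inr ⟨rfl, rfl⟩)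
  refine ⟨⟨?_, ?_⟩, ?_⟩
  · rintro ⟨a, b, hab, ha, hb, hu⟩ i j hij
    by_contra hc
    have h1 := (hu p q hpq').resolve_left fun h' => hq (h'.1 hp)
    have h2 := (hu i j ((h i j hc).2 (Or.inl hij))).resolve_left hc
    rw [h2.1, h2.2, ← h1.1, ← h1.2] at hij
    exact hpq hij
  · intro hn
    refine ⟨p, q, hpq', hp, hq, fun i j hij => ?_⟩
    by_cases hc : i ∈ S ↔ j ∈ S
    · exact Or.inl hc
    · exact ((h i j hc).1 hij).imp (hn i j) id
  · rintro ⟨a, b, hab, ha, hb, hu⟩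
    rcases hu p q hpq' with h1 | h1
    · rw [Finset.mem_compl, Finset.mem_compl] at h1
      exact (h1.2 hq) hp
    · rw [h1.1] at hp
      exact (Finset.mem_compl.1 ha) hp

theorem not_isCut {n : ℕ} {r : Fin n → Fin n → Prop} {S : Finset (Fin n)} {p q p' q' : Fin n}
    (h : r p q) (hc : ¬ (p ∈ S ↔ q ∈ S)) (h' : r p' q') (hc' : ¬ (p' ∈ S ↔ q' ∈ S))
    (hne : p ≠ p') : ¬ IsCut r S := by
  rintro ⟨a, b, -, -, -, hu⟩
  exact hne (((hu p q h).resolve_left hc).1.trans ((hu p' q' h').resolve_left hc').1.symm)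

variable {W} in
theorem clsOn_congr {n : ℕ} {r r' : Fin n → Fin n → Prop} (w : Fin n → Σ d, W d)
    {S : Finset (Fin n)} (h : ∀ i ∈ S, ∀ j ∈ S, (r i j ↔ r' i j)) :
    clsOn k r w S = clsOn k r' w S := by
  unfold clsOn
  congr 1
  funext i j
  exact propext (h _ (S.orderEmbOfFin_mem rfl i) _ (S.orderEmbOfFin_mem rfl j))

variable {W} in
theorem lieTerm_congr {n : ℕ} {r r' : Fin n → Fin n → Prop} (w : Fin n → Σ d, W d)
    {S : Finset (Fin n)} (h : ∀ i j, (i ∈ S ↔ j ∈ S) → (r i j ↔ r' i j)) :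
    lieTerm k r w S = lieTerm k r' w S := by
  have h1 := clsOn_congr k w (S := S) (fun i hi j hj => h i j (iff_of_true hi hj))
  have h2 := clsOn_congr k w (S := Sᶜ) (fun i hi j hj =>
    h i j (iff_of_false (Finset.mem_compl.1 hi) (Finset.mem_compl.1 hj)))
  rw [lieTerm_eq, lieTerm_eq, h1, h2]

theorem isOrientedTree_on {n : ℕ} (G : OrientedTree (Fin n)) (S : Finset (Fin n))
    (h : IsCut G.arrow S ∨ IsCut G.arrow Sᶜ) : IsOrientedTree
      (fun i j : Fin S.card => G.arrow (S.orderEmbOfFin rfl i) (S.orderEmbOfFin rfl j)) := by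
  rcases h with h | h
  · obtain ⟨e, rfl⟩ := exists_srcSide_eq G S h
    exact (G.restrict _ (G.connected_srcSide e)).isOrientedTree
  · obtain ⟨e, he⟩ := exists_srcSide_eq G Sᶜ h
    have h' : G.tgtSide e = S := by rw [G.tgtSide_eq_compl, he, compl_compl]
    subst h'
    exact (G.restrict _ (G.connected_tgtSide e)).isOrientedTree

variable {W} in
theorem mkQ_arn {z : GraphSpace k W} (h : ArnRel k W z) : (arn k W).mkQ z = 0 :=
  (Submodule.Quotient.mk_eq_zero _).2 (Submodule.subset_span h)

variable {W} in
theorem clsOn_reverse {n : ℕ} (G G' : OrientedTree (Fin n)) (w : Fin n → Σ d, W d)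
    (S : Finset (Fin n)) {r : Fin n → Fin n → Prop} {a b : Fin n}
    (hG : ∀ i j, G.arrow i j ↔ r i j ∨ (i = a ∧ j = b))
    (hG' : ∀ i j, G'.arrow i j ↔ r i j ∨ (i = b ∧ j = a)) (ha : a ∈ S) (hb : b ∈ S)
    (h : IsCut G.arrow S ∨ IsCut G.arrow Sᶜ) (h' : IsCut G'.arrow S ∨ IsCut G'.arrow Sᶜ) :
    (arn k W).mkQ (clsOn k G.arrow w S) + (arn k W).mkQ (clsOn k G'.arrow w S) = 0 := by
  obtain ⟨a', rfl⟩ := exists_orderEmb S a ha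
  obtain ⟨b', rfl⟩ := exists_orderEmb S b hb
  unfold clsOn clsRaw
  rw [dif_pos (isOrientedTree_on G S h), dif_pos (isOrientedTree_on G' S h'), ← map_add]
  refine mkQ_arn k (ArnRel.reverse _ _ _
    ⟨fun i j => r (S.orderEmbOfFin rfl i) (S.orderEmbOfFin rfl j), a', b', ?_, ?_⟩)
  · intro i j
    simp [hG]
  · intro i j
    simp [hG']

variable {W} in
theorem clsOn_arnold {n : ℕ} (G₁ G₂ G₃ : OrientedTree (Fin n)) (w : Fin n → Σ d, W d)
    (S : Finset (Fin n)) {r : Fin n → Fin n → Prop} {a b c : Fin n}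
    (hab : ¬ r a b) (hbc : ¬ r b c) (hca : ¬ r c a)
    (h₁ : ∀ i j, G₁.arrow i j ↔ r i j ∨ (i = a ∧ j = b) ∨ (i = b ∧ j = c))
    (h₂ : ∀ i j, G₂.arrow i j ↔ r i j ∨ (i = b ∧ j = c) ∨ (i = c ∧ j = a))
    (h₃ : ∀ i j, G₃.arrow i j ↔ r i j ∨ (i = c ∧ j = a) ∨ (i = a ∧ j = b))
    (ha : a ∈ S) (hb : b ∈ S) (hc : c ∈ S)
    (k₁ : IsCut G₁.arrow S ∨ IsCut G₁.arrow Sᶜ) (k₂ : IsCut G₂.arrow S ∨ IsCut G₂.arrow Sᶜ)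
    (k₃ : IsCut G₃.arrow S ∨ IsCut G₃.arrow Sᶜ) :
    (arn k W).mkQ (clsOn k G₁.arrow w S) + (arn k W).mkQ (clsOn k G₂.arrow w S) +
      (arn k W).mkQ (clsOn k G₃.arrow w S) = 0 := by
  obtain ⟨a', rfl⟩ := exists_orderEmb S a ha
  obtain ⟨b', rfl⟩ := exists_orderEmb S b hb
  obtain ⟨c', rfl⟩ := exists_orderEmb S c hc
  unfold clsOn clsRaw
  rw [dif_pos (isOrientedTree_on G₁ S k₁), dif_pos (isOrientedTree_on G₂ S k₂),
    dif_pos (isOrientedTree_on G₃ S k₃), ← map_add, ← map_add]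
  refine mkQ_arn k (ArnRel.arnold _ _ _ _
    ⟨fun i j => r (S.orderEmbOfFin rfl i) (S.orderEmbOfFin rfl j), a', b', c', hab, hbc, hca,
      ?_, ?_, ?_⟩)
  · intro i j
    simp [h₁]
  · intro i j
    simp [h₂]
  · intro i j
    simp [h₃]

variable {W} in
theorem lieContrib_reverse {n : ℕ} (G G' : OrientedTree (Fin n)) (w : Fin n → Σ d, W d)
    (S : Finset (Fin n)) (h : G.ArrowReversal G') :
    lieContrib k G.arrow w S + lieContrib k G'.arrow w S = 0 := by
  classical
  obtain ⟨r, a, b, hG, hG'⟩ := h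
  have hab : ¬ r a b := fun h =>
    G'.isOrientedTree.1 a b ((hG' a b).2 (Or.inl h)) ((hG' b a).2 (Or.inr ⟨rfl, rfl⟩))
  have hba : ¬ r b a := fun h =>
    G.isOrientedTree.1 a b ((hG a b).2 (Or.inr ⟨rfl, rfl⟩)) ((hG b a).2 (Or.inl h))
  unfold lieContrib
  by_cases hs : a ∈ S ↔ b ∈ S
  · have e1 : IsCut G.arrow S ↔ IsCut G'.arrow S := isCut_congr fun i j hij => by
      rw [hG, hG']
      grind
    have e2 : IsCut G.arrow Sᶜ ↔ IsCut G'.arrow Sᶜ := isCut_congr fun i j hij => by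
      rw [hG, hG']
      simp only [Finset.mem_compl] at hij
      grind
    have key : IsCut G.arrow S ∨ IsCut G.arrow Sᶜ →
        lieTerm k G.arrow w S + lieTerm k G'.arrow w S = 0 := by
      intro hcut
      have hcut' : IsCut G'.arrow S ∨ IsCut G'.arrow Sᶜ := by rwa [← e1, ← e2]
      rw [lieTerm_eq, lieTerm_eq, ← smul_add]
      by_cases ha : a ∈ S
      · have hb := hs.1 ha
        have e3 : clsOn k G.arrow w Sᶜ = clsOn k G'.arrow w Sᶜ := clsOn_congr k w
          fun i hi j hj => by
            rw [hG, hG']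
            simp only [Finset.mem_compl] at hi hj
            grind
        rw [e3, ← TensorProduct.add_tmul, clsOn_reverse k G G' w S hG hG' ha hb hcut hcut',
          TensorProduct.zero_tmul, smul_zero]
      · have hb : b ∉ S := fun h => ha (hs.2 h)
        have e3 : clsOn k G.arrow w S = clsOn k G'.arrow w S := clsOn_congr k w
          fun i hi j hj => by
            rw [hG, hG']
            grind
        rw [e3, ← TensorProduct.tmul_add, clsOn_reverse k G G' w Sᶜ hG hG'
          (Finset.mem_compl.2 ha) (Finset.mem_compl.2 hb) (by rw [compl_compl]; exact hcut.symm)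
          (by rw [compl_compl]; exact hcut'.symm), TensorProduct.tmul_zero, smul_zero]
    by_cases c1 : IsCut G.arrow S <;> by_cases c2 : IsCut G.arrow Sᶜ
    · rw [if_pos c1, if_pos c2, if_pos (e1.1 c1), if_pos (e2.1 c2)]
      abel
    · rw [if_pos c1, if_neg c2, if_pos (e1.1 c1), if_neg (fun h => c2 (e2.2 h)), sub_zero, sub_zero]
      exact key (Or.inl c1)
    · rw [if_neg c1, if_pos c2, if_neg (fun h => c1 (e1.2 h)), if_pos (e2.1 c2), zero_sub, zero_sub,
        ← neg_add, key (Or.inr c2), neg_zero]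
    · rw [if_neg c1, if_neg c2, if_neg (fun h => c1 (e1.2 h)), if_neg (fun h => c2 (e2.2 h))]
      simp
  · have e0 : lieTerm k G.arrow w S = lieTerm k G'.arrow w S := lieTerm_congr k w
      fun i j hij => by
        rw [hG, hG']
        grind
    have hn : (∀ i j, r i j → (i ∈ Sᶜ ↔ j ∈ Sᶜ)) ↔ ∀ i j, r i j → (i ∈ S ↔ j ∈ S) := by
      simp only [Finset.mem_compl, not_iff_not]
    have e : (IsCut G.arrow S ↔ IsCut G'.arrow Sᶜ) ∧ (IsCut G.arrow Sᶜ ↔ IsCut G'.arrow S) := by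
      by_cases ha : a ∈ S
      · have hb : b ∉ S := fun h => hs (iff_of_true ha h)
        have f1 := isCut_iff (r' := G.arrow) ha hb hab (fun i j _ => hG i j)
        have f2 := isCut_iff (r' := G'.arrow) (Finset.mem_compl.2 hb)
          (fun h => (Finset.mem_compl.1 h) ha) hba (fun i j _ => hG' i j)
        rw [compl_compl, hn] at f2
        exact ⟨f1.1.trans f2.1.symm, iff_of_false f1.2 f2.2⟩
      · have hb : b ∈ S := by
          by_contra hb
          exact hs (iff_of_false ha hb)
        have f1 := isCut_iff (r' := G'.arrow) hb ha hba (fun i j _ => hG' i j)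
        have f2 := isCut_iff (r' := G.arrow) (Finset.mem_compl.2 ha)
          (fun h => (Finset.mem_compl.1 h) hb) hab (fun i j _ => hG i j)
        rw [compl_compl, hn] at f2
        exact ⟨iff_of_false f2.2 f1.2, f2.1.trans f1.1.symm⟩
    rw [← e0]
    simp only [← e.1, ← e.2]
    abel

variable {W} in
/-- The case of the Arnold relation where `c` is separated from `a` and `b`. -/
theorem lieContrib_arnold_mixed {n : ℕ} (G₁ G₂ G₃ : OrientedTree (Fin n))
    (w : Fin n → Σ d, W d) (S : Finset (Fin n)) {r : Fin n → Fin n → Prop} {a b c : Fin n}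
    (hbc : ¬ r b c) (hca : ¬ r c a)
    (h₁ : ∀ i j, G₁.arrow i j ↔ r i j ∨ (i = a ∧ j = b) ∨ (i = b ∧ j = c))
    (h₂ : ∀ i j, G₂.arrow i j ↔ r i j ∨ (i = b ∧ j = c) ∨ (i = c ∧ j = a))
    (h₃ : ∀ i j, G₃.arrow i j ↔ r i j ∨ (i = c ∧ j = a) ∨ (i = a ∧ j = b))
    (hs : a ∈ S ↔ b ∈ S) (hs' : ¬ (a ∈ S ↔ c ∈ S)) :
    lieContrib k G₁.arrow w S + lieContrib k G₂.arrow w S + lieContrib k G₃.arrow w S = 0 := by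
  classical
  have hn : (∀ i j, r i j → (i ∈ Sᶜ ↔ j ∈ Sᶜ)) ↔ ∀ i j, r i j → (i ∈ S ↔ j ∈ S) := by
    simp only [Finset.mem_compl, not_iff_not]
  have e0 : lieTerm k G₁.arrow w S = lieTerm k G₃.arrow w S := lieTerm_congr k w
    fun i j hij => by
      rw [h₁, h₃]
      grind
  have hbne : b ≠ c := by
    rintro rfl
    exact hs' hs
  have n1 : ¬ IsCut G₂.arrow S := not_isCut ((h₂ b c).2 (Or.inr (Or.inl ⟨rfl, rfl⟩)))
    (by rwa [← hs]) ((h₂ c a).2 (Or.inr (Or.inr ⟨rfl, rfl⟩))) (fun h => hs' h.symm) hbne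
  have n2 : ¬ IsCut G₂.arrow Sᶜ := not_isCut ((h₂ b c).2 (Or.inr (Or.inl ⟨rfl, rfl⟩)))
    (by simp only [Finset.mem_compl, not_iff_not]; rwa [← hs])
    ((h₂ c a).2 (Or.inr (Or.inr ⟨rfl, rfl⟩)))
    (by simp only [Finset.mem_compl, not_iff_not]; exact fun h => hs' h.symm) hbne
  have e : (IsCut G₁.arrow S ↔ IsCut G₃.arrow Sᶜ) ∧ (IsCut G₁.arrow Sᶜ ↔ IsCut G₃.arrow S) := by
    by_cases hc : c ∈ S
    · have ha : a ∉ S := fun h => hs' (iff_of_true h hc)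
      have hb : b ∉ S := fun h => ha (hs.2 h)
      have f1 := isCut_iff (r' := G₃.arrow) hc ha hca (fun i j hij => by rw [h₃]; grind)
      have f2 := isCut_iff (r' := G₁.arrow) (Finset.mem_compl.2 hb)
        (fun h => (Finset.mem_compl.1 h) hc) hbc
        (fun i j hij => by rw [h₁]; simp only [Finset.mem_compl] at hij; grind)
      rw [compl_compl, hn] at f2
      exact ⟨iff_of_false f2.2 f1.2, f2.1.trans f1.1.symm⟩
    · have ha : a ∈ S := by
        by_contra h
        exact hs' (iff_of_false h hc)
      have hb : b ∈ S := hs.1 ha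
      have f1 := isCut_iff (r' := G₁.arrow) hb hc hbc (fun i j hij => by rw [h₁]; grind)
      have f2 := isCut_iff (r' := G₃.arrow) (Finset.mem_compl.2 hc)
        (fun h => (Finset.mem_compl.1 h) ha) hca
        (fun i j hij => by rw [h₃]; simp only [Finset.mem_compl] at hij; grind)
      rw [compl_compl, hn] at f2
      exact ⟨f1.1.trans f2.1.symm, iff_of_false f1.2 f2.2⟩
  unfold lieContrib
  rw [e0, if_neg n1, if_neg n2]
  simp only [e.1, e.2]
  abel

variable {W} in
theorem lieContrib_arnold {n : ℕ} (G₁ G₂ G₃ : OrientedTree (Fin n)) (w : Fin n → Σ d, W d)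
    (S : Finset (Fin n)) (h : OrientedTree.ArnoldTriple G₁ G₂ G₃) :
    lieContrib k G₁.arrow w S + lieContrib k G₂.arrow w S + lieContrib k G₃.arrow w S = 0 := by
  classical
  obtain ⟨r, a, b, c, hab, hbc, hca, h₁, h₂, h₃⟩ := h
  by_cases hs : a ∈ S ↔ b ∈ S
  · by_cases hs' : a ∈ S ↔ c ∈ S
    · have e1 : IsCut G₁.arrow S ↔ IsCut G₂.arrow S := isCut_congr fun i j hij => by
        rw [h₁, h₂]
        grind
      have e2 : IsCut G₁.arrow S ↔ IsCut G₃.arrow S := isCut_congr fun i j hij => by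
        rw [h₁, h₃]
        grind
      have e1' : IsCut G₁.arrow Sᶜ ↔ IsCut G₂.arrow Sᶜ := isCut_congr fun i j hij => by
        rw [h₁, h₂]
        simp only [Finset.mem_compl] at hij
        grind
      have e2' : IsCut G₁.arrow Sᶜ ↔ IsCut G₃.arrow Sᶜ := isCut_congr fun i j hij => by
        rw [h₁, h₃]
        simp only [Finset.mem_compl] at hij
        grind
      have key : IsCut G₁.arrow S ∨ IsCut G₁.arrow Sᶜ →
          lieTerm k G₁.arrow w S + lieTerm k G₂.arrow w S + lieTerm k G₃.arrow w S = 0 := by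
        intro k₁
        have k₂ : IsCut G₂.arrow S ∨ IsCut G₂.arrow Sᶜ := by rwa [← e1, ← e1']
        have k₃ : IsCut G₃.arrow S ∨ IsCut G₃.arrow Sᶜ := by rwa [← e2, ← e2']
        rw [lieTerm_eq, lieTerm_eq, lieTerm_eq, ← smul_add, ← smul_add]
        by_cases ha : a ∈ S
        · have e3 : clsOn k G₂.arrow w Sᶜ = clsOn k G₁.arrow w Sᶜ := clsOn_congr k w
            fun i hi j hj => by
              rw [h₁, h₂]
              simp only [Finset.mem_compl] at hi hj
              grind
          have e4 : clsOn k G₃.arrow w Sᶜ = clsOn k G₁.arrow w Sᶜ := clsOn_congr k w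
            fun i hi j hj => by
              rw [h₁, h₃]
              simp only [Finset.mem_compl] at hi hj
              grind
          rw [e3, e4, ← TensorProduct.add_tmul, ← TensorProduct.add_tmul,
            clsOn_arnold k G₁ G₂ G₃ w S hab hbc hca h₁ h₂ h₃ ha (hs.1 ha) (hs'.1 ha) k₁ k₂ k₃,
            TensorProduct.zero_tmul, smul_zero]
        · have hb : b ∉ S := fun h => ha (hs.2 h)
          have hc : c ∉ S := fun h => ha (hs'.2 h)
          have e3 : clsOn k G₂.arrow w S = clsOn k G₁.arrow w S := clsOn_congr k w
            fun i hi j hj => by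
              rw [h₁, h₂]
              grind
          have e4 : clsOn k G₃.arrow w S = clsOn k G₁.arrow w S := clsOn_congr k w
            fun i hi j hj => by
              rw [h₁, h₃]
              grind
          rw [e3, e4, ← TensorProduct.tmul_add, ← TensorProduct.tmul_add,
            clsOn_arnold k G₁ G₂ G₃ w Sᶜ hab hbc hca h₁ h₂ h₃ (Finset.mem_compl.2 ha)
              (Finset.mem_compl.2 hb) (Finset.mem_compl.2 hc) (by rw [compl_compl]; exact k₁.symm)
              (by rw [compl_compl]; exact k₂.symm) (by rw [compl_compl]; exact k₃.symm),
            TensorProduct.tmul_zero, smul_zero]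
      unfold lieContrib
      simp only [← e1, ← e2, ← e1', ← e2']
      by_cases c1 : IsCut G₁.arrow S <;> by_cases c2 : IsCut G₁.arrow Sᶜ
      · simp only [if_pos c1, if_pos c2]
        abel
      · simp only [if_pos c1, if_neg c2, sub_zero]
        exact key (Or.inl c1)
      · simp only [if_neg c1, if_pos c2, zero_sub, ← neg_add]
        rw [key (Or.inr c2), neg_zero]
      · simp only [if_neg c1, if_neg c2]
        simp
    · exact lieContrib_arnold_mixed k G₁ G₂ G₃ w S hbc hca h₁ h₂ h₃ hs hs'
  · by_cases hs' : a ∈ S ↔ c ∈ S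
    · have h := lieContrib_arnold_mixed k G₃ G₁ G₂ w S hab hbc h₃ h₁ h₂ hs'.symm
        (by rw [← hs']; exact hs)
      rw [← h]
      abel
    · have hs'' : b ∈ S ↔ c ∈ S := by tauto
      have h := lieContrib_arnold_mixed k G₂ G₃ G₁ w S hca hab h₂ h₃ h₁ hs''
        (fun h => hs h.symm)
      rw [← h]
      abel

theorem arn_le_ker : arn k W ≤ LinearMap.ker
    (TensorProduct.map (arn k W).mkQ (arn k W).mkQ ∘ₗ graphCobracket k W) := by
  unfold arn
  rw [Submodule.span_le]
  change {z | ArnRel k W z} ⊆ (LinearMap.ker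
    (TensorProduct.map (arn k W).mkQ (arn k W).mkQ ∘ₗ graphCobracket k W) : Set (GraphSpace k W))
  rintro z (⟨G, G', w, h⟩ | ⟨G₁, G₂, G₃, w, h⟩)
  · rw [SetLike.mem_coe, LinearMap.mem_ker, map_add, LinearMap.comp_apply, LinearMap.comp_apply,
      map_treeCobracket, map_treeCobracket, ← Finset.sum_add_distrib]
    exact Finset.sum_eq_zero fun S _ => lieContrib_reverse k G G' w S h
  · rw [SetLike.mem_coe, LinearMap.mem_ker, map_add, map_add, LinearMap.comp_apply,
      LinearMap.comp_apply, LinearMap.comp_apply, map_treeCobracket, map_treeCobracket,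
      map_treeCobracket, ← Finset.sum_add_distrib, ← Finset.sum_add_distrib]
    exact Finset.sum_eq_zero fun S _ => lieContrib_arnold k G₁ G₂ G₃ w S h

/-- The cobracket of the Lie coalgebra, induced by the graph cobracket. -/
noncomputable def lieCobracket : LieSpace k W →ₗ[k] LieSpace k W ⊗[k] LieSpace k W :=
  (arn k W).liftQ (TensorProduct.map (arn k W).mkQ (arn k W).mkQ ∘ₗ graphCobracket k W)
    (arn_le_ker k W)

end Coalgebra

/-- The `m`-fold iterated cobracket `C → C^{⊗(m+1)}`: apply the cobracket, and then the
`(m-1)`-fold iterated cobracket to the left factor. -/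
noncomputable def iterCobracket {k C : Type*} [Field k] [AddCommGroup C] [Module k C]
    (δ : C →ₗ[k] C ⊗[k] C) : (m : ℕ) → C →ₗ[k] ⨂[k]^(m + 1) C
  | 0 => (PiTensorProduct.subsingletonEquiv (R := k) (s := fun _ : Fin 1 => C) 0).symm.toLinearMap
  | m + 1 => (TensorPower.mulEquiv (R := k) (M := C) (n := m + 1) (m := 1)).toLinearMap ∘ₗ
      TensorProduct.map (iterCobracket δ m)
        (PiTensorProduct.subsingletonEquiv (R := k) (s := fun _ : Fin 1 => C) 0).symm.toLinearMap
      ∘ₗ δ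

end GraphCoalgebra

namespace GraphCoalgebra

open Relation

namespace OrientedTree

/-! ### Exchanging one edge of a tree -/

section Redirect

variable {V : Type*} (G : OrientedTree V)

/-! The argument is a graph version of the Dynkin–Specht–Wever lemma: reading tensors as path graphs
recovers `n` times the class of an element from its iterated cobracket.

Cutting a tree with `n` vertices `n - 1` times, always continuing in the left factor, leaves single
vertices only if each cut detaches one leaf as right factor. Hence the iterated cobracket is a sum
over orderings of the vertices (`iterCobracket_cls`). An ordering contributes its Koszul sign times
a product of factors, one for each vertex after the first: `1` or `-1` if exactly one arrow joins
that vertex to the earlier ones, according to whether it points to the later or to the earlier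
vertex, and `0` otherwise.

Let `pathMap` send `w₀ ⊗ ⋯ ⊗ wₘ` to the class of the path `0 → ⋯ → m` with these labels. The key
identity is `sum_paths_eq`: for every vertex `i`, the terms of the orderings that start at `i` are
mapped to elements with sum the class of the tree. Both sides change sign when an arrow is reversed,
so the tree may be assumed rooted at `i`. Its coefficients are then the indicator function of its
linear extensions. The Arnold relation splits a fork `b ← a → c` into the trees with `a → b → c` and
`a → c → b`, while the linear extensions split according to whether `b` or `c` comes first. Repeated
splitting ends at paths, which have exactly one linear extension. Summing over `i` gives `n` times
the class (`pathMap_iterCobracket`), and in characteristic zero `n` can be cancelled. So a vanishing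
iterated cobracket forces the class to vanish.

Conversely, the quotient map commutes with the cobrackets, so an element of `arn` has an iterated
cobracket that dies in the quotient. It is a tensor of single vertices, and on these the quotient
map is injective (`map_mkQ_injOn_pointTensors`), because `arn` only involves trees that have an
arrow. Thus it already vanishes among graphs. The same injectivity transfers the criterion from
graphs to the quotient. -/

theorem isOrientedTree_redirect (e : G.Edge) {x y : V} (h : ¬ (G.cut e).Reachable x y) :
    IsOrientedTree fun i j =>
      (G.arrow i j ∧ ¬ (i = e.1.1 ∧ j = e.1.2)) ∨ (i = x ∧ j = y) := by
  have hne : x ≠ y := by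
    rintro rfl
    exact h (SimpleGraph.Reachable.refl _)
  have hcut : ∀ i j, (G.cut e).Adj i j ↔
      (G.arrow i j ∧ ¬ (i = e.1.1 ∧ j = e.1.2)) ∨ (G.arrow j i ∧ ¬ (j = e.1.1 ∧ i = e.1.2)) := by
    intro i j
    have h1 := G.isOrientedTree.1 i j
    have h2 := e.2
    rw [cut_adj]
    grind
  have hxy : ∀ i j, (G.arrow i j ∧ ¬ (i = e.1.1 ∧ j = e.1.2)) → ¬ (i = y ∧ j = x) := by
    rintro i j hij ⟨rfl, rfl⟩
    exact h ((hcut _ _).2 (Or.inr hij)).reachable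
  refine ⟨?_, ?_⟩
  · intro a b hab hba
    have h1 := G.isOrientedTree.1 a b
    have h2 := hxy a b
    have h3 := hxy b a
    grind
  have heq : SimpleGraph.fromRel (fun i j =>
      (G.arrow i j ∧ ¬ (i = e.1.1 ∧ j = e.1.2)) ∨ (i = x ∧ j = y)) =
      G.cut e ⊔ SimpleGraph.edge x y := by
    ext i j
    rw [SimpleGraph.fromRel_adj, SimpleGraph.sup_adj, SimpleGraph.edge_adj, hcut]
    have h1 : G.arrow i j → i ≠ j := by
      rintro h1 rfl
      exact G.isOrientedTree.1 _ _ h1 h1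
    have h2 : G.arrow j i → i ≠ j := by
      rintro h1 rfl
      exact G.isOrientedTree.1 _ _ h1 h1
    grind
  rw [heq]
  have hac : G.toSimple.IsAcyclic := G.isOrientedTree.2.2
  refine ⟨?_, SimpleGraph.IsAcyclic.sup_edge_of_not_reachable h
    (hac.anti (SimpleGraph.deleteEdges_le _))⟩
  have hnew : (G.cut e ⊔ SimpleGraph.edge x y).Reachable x y :=
    SimpleGraph.Adj.reachable (by
      rw [SimpleGraph.sup_adj, SimpleGraph.edge_adj]
      exact Or.inr ⟨Or.inl ⟨rfl, rfl⟩, hne⟩)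
  have hmono : ∀ {u v}, (G.cut e).Reachable u v →
      (G.cut e ⊔ SimpleGraph.edge x y).Reachable u v := fun h => h.mono le_sup_left
  -- Since `x` and `y` lie in different components, the new arrow bridges the two sides of `e`, in
  -- one direction or the other.
  have hpq : (G.cut e ⊔ SimpleGraph.edge x y).Reachable e.1.1 e.1.2 := by
    rcases G.reachable_cut e x with hx | hx <;> rcases G.reachable_cut e y with hy | hy
    · exact absurd (hx.symm.trans hy) h
    · exact ((hmono hx).trans hnew).trans (hmono hy).symm
    · exact ((hmono hy).trans hnew.symm).trans (hmono hx).symm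
    · exact absurd (hx.symm.trans hy) h
  refine (SimpleGraph.connected_iff_exists_forall_reachable _).2 ⟨e.1.1, fun v => ?_⟩
  rcases G.reachable_cut e v with hv | hv
  · exact hmono hv
  · exact hpq.trans (hmono hv)

/-- The tree obtained by replacing the edge `e` by an arrow `x → y` that joins the two components
of the graph without `e`. -/
def redirect (e : G.Edge) (x y : V) (h : ¬ (G.cut e).Reachable x y) : OrientedTree V :=
  ⟨_, G.isOrientedTree_redirect e h⟩

theorem arrow_ne {a b : V} (h : G.arrow a b) : a ≠ b := by
  rintro rfl
  exact G.isOrientedTree.1 _ _ h h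

theorem exists_reverse {a b : V} (hab : G.arrow a b) :
    ∃ G' : OrientedTree V, G.ArrowReversal G' ∧
      ∀ i j, G'.arrow i j ↔ (G.arrow i j ∧ ¬ (i = a ∧ j = b)) ∨ (i = b ∧ j = a) := by
  refine ⟨G.redirect ⟨(a, b), hab⟩ b a fun h => G.not_reachable_cut ⟨(a, b), hab⟩ h.symm,
    ⟨fun i j => G.arrow i j ∧ ¬ (i = a ∧ j = b), a, b, ?_, fun i j => Iff.rfl⟩, fun i j => Iff.rfl⟩
  intro i j
  grind

/-- Once `a → c` is removed, `b` is still joined to `a` by the other arm of the fork, so an arrow `b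
→ c` reconnects the two components. -/
theorem exists_slide {a b c : V} (hab : G.arrow a b) (hac : G.arrow a c) (hbc : b ≠ c) :
    ∃ G' : OrientedTree V,
      ∀ i j, G'.arrow i j ↔ (G.arrow i j ∧ ¬ (i = a ∧ j = c)) ∨ (i = b ∧ j = c) := by
  refine ⟨G.redirect ⟨(a, c), hac⟩ b c fun h => ?_, fun i j => Iff.rfl⟩
  have hadj : (G.cut ⟨(a, c), hac⟩).Adj a b := by
    rw [cut_adj]
    have := G.arrow_ne hac
    grind
  exact G.not_reachable_cut ⟨(a, c), hac⟩ (hadj.reachable.trans h)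

/-- A triangle would let `a` reach `c` after `a → c` is cut. -/
theorem not_arrow_siblings {a b c : V} (hab : G.arrow a b) (hac : G.arrow a c) :
    ¬ G.arrow b c := by
  intro hbc
  have hadj : (G.cut ⟨(a, c), hac⟩).Adj a b := by
    rw [cut_adj]
    have := G.arrow_ne hbc
    grind
  have hadj' : (G.cut ⟨(a, c), hac⟩).Adj b c := by
    rw [cut_adj]
    have := G.arrow_ne hab
    grind
  exact G.not_reachable_cut ⟨(a, c), hac⟩ (hadj.reachable.trans hadj'.reachable)

end Redirect

/-! ### Rooted trees and their reduction to paths -/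

section Rooted

variable {n : ℕ} (G : OrientedTree (Fin n))

/-- All arrows point away from the vertex `i`. -/
def IsRootedAt (i : Fin n) : Prop := ∀ v, ReflTransGen G.arrow i v

variable {G}

/-- The only arrow across the cut leaves the source side, so a directed walk can never return to it.
-/
theorem notMem_srcSide_of_reflTransGen (e : G.Edge) {x y : Fin n} (h : ReflTransGen G.arrow x y)
    (hx : x ∉ G.srcSide e) : y ∉ G.srcSide e := by
  induction h with
  | refl => exact hx
  | @tail z t _ hzt ih =>
    obtain ⟨h1, h2, h3⟩ := srcSide_spec G e
    rcases h3 _ _ hzt with h | h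
    · rwa [← h]
    · rw [h.2]
      exact h2

/-- A directed walk that leaves the source side has to traverse `e` itself. -/
theorem exit_srcSide (e : G.Edge) {x y : Fin n} (h : ReflTransGen G.arrow x y)
    (hx : x ∈ G.srcSide e) (hy : y ∉ G.srcSide e) :
    ReflTransGen G.arrow x e.1.1 ∧ ReflTransGen G.arrow e.1.2 y := by
  induction h with
  | refl => exact absurd hx hy
  | @tail z t hxz hzt ih =>
    by_cases hz : z ∈ G.srcSide e
    · rcases (srcSide_spec G e).2.2 _ _ hzt with h | h
      · exact absurd (h.1 hz) hy
      · rw [← h.1, ← h.2]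
        exact ⟨hxz, ReflTransGen.refl⟩
    · exact ⟨(ih hz).1, (ih hz).2.tail hzt⟩

theorem not_reflTransGen_of_arrow {x y : Fin n} (h : G.arrow x y) :
    ¬ ReflTransGen G.arrow y x := fun h' =>
  notMem_srcSide_of_reflTransGen ⟨(x, y), h⟩ h' (srcSide_spec G ⟨(x, y), h⟩).2.1
    (srcSide_spec G ⟨(x, y), h⟩).1

theorem reflTransGen_antisymm {x y : Fin n} (h : ReflTransGen G.arrow x y)
    (h' : ReflTransGen G.arrow y x) : x = y := by
  rcases ReflTransGen.cases_head h with rfl | ⟨z, hz, hzy⟩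
  · rfl
  · exact absurd (hzy.trans h') (not_reflTransGen_of_arrow hz)

/-- Cut at `u → v`. If `x` were on the side of `v`, the walk from the root to `x` would pass through
`v` and close a directed cycle with `x → v`. So `x → v` crosses the cut and is the arrow `u → v`. -/
theorem IsRootedAt.parent_unique {i : Fin n} (hG : G.IsRootedAt i) {u x v : Fin n}
    (hu : G.arrow u v) (hx : G.arrow x v) : x = u := by
  obtain ⟨h1, h2, h3⟩ := srcSide_spec G ⟨(u, v), hu⟩
  have hi : i ∈ G.srcSide ⟨(u, v), hu⟩ := by
    by_contra hi
    exact notMem_srcSide_of_reflTransGen _ (hG u) hi h1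
  rcases h3 _ _ hx with h | h
  · have hxS : x ∉ G.srcSide ⟨(u, v), hu⟩ := by rwa [h]
    exact absurd (exit_srcSide _ (hG x) hi hxS).2 (not_reflTransGen_of_arrow hx)
  · exact h.1

/-- A walk from `b` to `c` would use the arrow `a → c`, hence return from `b` to `a`. -/
theorem not_reflTransGen_siblings {a b c : Fin n} (hab : G.arrow a b) (hac : G.arrow a c)
    (hbc : b ≠ c) : ¬ ReflTransGen G.arrow b c := by
  intro h
  obtain ⟨h1, h2, h3⟩ := srcSide_spec G ⟨(a, c), hac⟩
  have hb : b ∈ G.srcSide ⟨(a, c), hac⟩ := by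
    rcases h3 _ _ hab with h | h
    · exact h.1 h1
    · exact absurd h.2 hbc
  exact not_reflTransGen_of_arrow hab (exit_srcSide _ h hb h2).1

/-- The lost arrow `a → c` is replaced by the walk `a → b → c`, so directed reachability only grows.
The last two clauses make it grow strictly in `slide_induction`. -/
theorem IsRootedAt.exists_slide {i : Fin n} (hG : G.IsRootedAt i) {a b c : Fin n}
    (hab : G.arrow a b) (hac : G.arrow a c) (hbc : b ≠ c) :
    ∃ G' : OrientedTree (Fin n), G'.IsRootedAt i ∧
      (∀ i j, G'.arrow i j ↔ (G.arrow i j ∧ ¬ (i = a ∧ j = c)) ∨ (i = b ∧ j = c)) ∧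
      (∀ x y, ReflTransGen G.arrow x y → ReflTransGen G'.arrow x y) ∧
      ReflTransGen G'.arrow b c := by
  obtain ⟨G', hG'⟩ := G.exists_slide hab hac hbc
  have hbc' : G'.arrow b c := (hG' _ _).2 (Or.inr ⟨rfl, rfl⟩)
  have hab' : G'.arrow a b := (hG' _ _).2 (Or.inl ⟨hab, fun h => hbc h.2⟩)
  have hmono : ∀ x y, ReflTransGen G.arrow x y → ReflTransGen G'.arrow x y := by
    intro x y h
    induction h with
    | refl => exact ReflTransGen.refl
    | @tail z t _ hzt ih =>
      by_cases h : z = a ∧ t = c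
      · obtain ⟨rfl, rfl⟩ := h
        exact (ih.tail hab').tail hbc'
      · exact ih.tail ((hG' _ _).2 (Or.inl ⟨hzt, h⟩))
  exact ⟨G', fun v => hmono _ _ (hG v), hG', hmono, ReflTransGen.single hbc'⟩

open Classical in
/-- Every tree can be reduced to trees rooted at `i` by reversing arrows. -/
theorem reverse_induction (i : Fin n) (P : OrientedTree (Fin n) → Prop)
    (hrev : ∀ G G', G.ArrowReversal G' → P G' → P G) (hroot : ∀ G, G.IsRootedAt i → P G)
    (G : OrientedTree (Fin n)) : P G := by
  induction hk : (Finset.univ.filter fun v => ¬ ReflTransGen G.arrow i v).card using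
    Nat.strong_induction_on generalizing G with
  | _ k ih =>
    by_cases hG : G.IsRootedAt i
    · exact hroot G hG
    -- By connectedness some edge joins the set reached from `i` to its complement. It must point
    -- into the set, and reversing it enlarges the set.
    have : ∃ x y, ReflTransGen G.arrow i x ∧ ¬ ReflTransGen G.arrow i y ∧ G.toSimple.Adj x y := by
      by_contra! hcon
      refine hG fun v => ?_
      have h := (SimpleGraph.reachable_iff_reflTransGen _ _).1
        (G.isOrientedTree.2.1.preconnected i v)
      induction h with
      | refl => exact ReflTransGen.refl
      | @tail x y _ hxy ih =>
        by_contra hy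
        exact hcon x y ih hy hxy
    obtain ⟨x, y, hx, hy, hxy⟩ := this
    have hyx : G.arrow y x := by
      rcases G.toSimple_adj.1 hxy with h | h
      · exact absurd (hx.tail h) hy
      · exact h
    obtain ⟨G', hGG', hG'⟩ := G.exists_reverse hyx
    -- A directed walk from `i` never uses `y → x`, as `y` is not reached.
    have hmono : ∀ v, ReflTransGen G.arrow i v → ReflTransGen G'.arrow i v := by
      intro v h
      induction h with
      | refl => exact ReflTransGen.refl
      | @tail z t hz hzt ih =>
        refine ih.tail ((hG' _ _).2 (Or.inl ⟨hzt, ?_⟩))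
        rintro ⟨rfl, -⟩
        exact hy hz
    refine hrev G G' hGG' (ih _ ?_ G' rfl)
    rw [← hk]
    refine Finset.card_lt_card (Finset.ssubset_iff_of_subset ?_ |>.2 ⟨y, ?_, ?_⟩)
    · intro v hv
      rw [Finset.mem_filter] at hv ⊢
      exact ⟨hv.1, fun h => hv.2 (hmono v h)⟩
    · simpa using hy
    · simpa using (hmono x hx).tail ((hG' _ _).2 (Or.inr ⟨rfl, rfl⟩))

open Classical in
/-- Every tree rooted at `i` can be reduced to paths by splitting forks. -/
theorem slide_induction (i : Fin n) (P : OrientedTree (Fin n) → Prop)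
    (hslide : ∀ G G' G'' : OrientedTree (Fin n), G.IsRootedAt i → G'.IsRootedAt i →
      G''.IsRootedAt i → ∀ a b c, G.arrow a b → G.arrow a c → b ≠ c →
      (∀ i j, G'.arrow i j ↔ (G.arrow i j ∧ ¬ (i = a ∧ j = c)) ∨ (i = b ∧ j = c)) →
      (∀ i j, G''.arrow i j ↔ (G.arrow i j ∧ ¬ (i = a ∧ j = b)) ∨ (i = c ∧ j = b)) →
      P G' → P G'' → P G)
    (hpath : ∀ G, G.IsRootedAt i → Relator.RightUnique G.arrow → P G)
    (G : OrientedTree (Fin n)) (hG : G.IsRootedAt i) : P G := by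
  -- The measure is the number of ordered pairs without a directed walk. A slide preserves all walks
  -- and adds one from `b` to `c`.
  induction hk : (Finset.univ.filter fun p : Fin n × Fin n =>
      ¬ ReflTransGen G.arrow p.1 p.2).card using Nat.strong_induction_on generalizing G with
  | _ k ih =>
    by_cases hu : Relator.RightUnique G.arrow
    · exact hpath G hG hu
    have : ∃ a b c, G.arrow a b ∧ G.arrow a c ∧ b ≠ c := by
      by_contra! hcon
      exact hu fun a b c hb hc => hcon a b c hb hc
    obtain ⟨a, b, c, hab, hac, hbc⟩ := this
    have key : ∀ b c, G.arrow a b → G.arrow a c → b ≠ c → ∃ G' : OrientedTree (Fin n),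
        G'.IsRootedAt i ∧
        (∀ i j, G'.arrow i j ↔ (G.arrow i j ∧ ¬ (i = a ∧ j = c)) ∨ (i = b ∧ j = c)) ∧ P G' := by
      intro b c hab hac hbc
      obtain ⟨G', h1, h2, h3, h4⟩ := hG.exists_slide hab hac hbc
      refine ⟨G', h1, h2, ih _ ?_ G' h1 rfl⟩
      rw [← hk]
      refine Finset.card_lt_card (Finset.ssubset_iff_of_subset ?_ |>.2 ⟨(b, c), ?_, ?_⟩)
      · intro p hp
        rw [Finset.mem_filter] at hp ⊢
        exact ⟨hp.1, fun h => hp.2 (h3 _ _ h)⟩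
      · simpa using not_reflTransGen_siblings hab hac hbc
      · simpa using h4
    obtain ⟨G', h1, h2, h3⟩ := key b c hab hac hbc
    obtain ⟨G'', h1', h2', h3'⟩ := key c b hac hab hbc.symm
    exact hslide G G' G'' hG h1 h1' a b c hab hac hbc h2 h2' h3 h3'

open Classical in
/-- A rooted tree without forks is a path. -/
theorem IsRootedAt.exists_path {m : ℕ} {G : OrientedTree (Fin (m + 1))} {i : Fin (m + 1)}
    (hG : G.IsRootedAt i) (hu : Relator.RightUnique G.arrow) :
    ∃ e : Fin (m + 1) ≃ Fin (m + 1), e 0 = i ∧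
      ∀ x y, G.arrow x y ↔ (e.symm x : ℕ) + 1 = e.symm y := by
  -- The position of a vertex on the path is the number of its proper ancestors.
  let S : Fin (m + 1) → Finset (Fin (m + 1)) := fun x =>
    Finset.univ.filter fun y => ReflTransGen G.arrow y x ∧ y ≠ x
  have hS : ∀ x, (S x).card < m + 1 := fun x => by
    conv_rhs => rw [← Fintype.card_fin (m + 1)]
    exact Finset.card_lt_univ_of_notMem (x := x) (by simp [S])
  let f : Fin (m + 1) → Fin (m + 1) := fun x => ⟨(S x).card, hS x⟩
  have hlt : ∀ x y, ReflTransGen G.arrow x y → x ≠ y → f x < f y := by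
    intro x y hxy hne
    change (S x).card < (S y).card
    refine Finset.card_lt_card (Finset.ssubset_iff_of_subset ?_ |>.2 ⟨x, ?_, ?_⟩)
    · intro z hz
      simp only [S, Finset.mem_filter, Finset.mem_univ, true_and] at hz ⊢
      refine ⟨hz.1.trans hxy, ?_⟩
      rintro rfl
      exact hne (reflTransGen_antisymm hxy hz.1)
    · simpa [S] using ⟨hxy, hne⟩
    · simp [S]
  -- Without forks, two walks from the root follow the same arrows, so one extends the other.
  have htot : ∀ x y, ReflTransGen G.arrow x y ∨ ReflTransGen G.arrow y x := fun x y =>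
    ReflTransGen.total_of_right_unique hu (hG x) (hG y)
  have hlt' : ∀ x y, f x < f y → ReflTransGen G.arrow x y := by
    intro x y h
    rcases htot x y with h' | h'
    · exact h'
    · by_cases hne : y = x
      · subst hne; exact h'
      · exact absurd (hlt _ _ h' hne) h.not_gt
  have hinj : Function.Injective f := by
    intro x y h
    by_contra hne
    rcases htot x y with h' | h'
    · exact (hlt _ _ h' hne).ne h
    · exact (hlt _ _ h' (Ne.symm hne)).ne h.symm
  let e := Equiv.ofBijective f (Finite.injective_iff_bijective.1 hinj)
  refine ⟨e.symm, ?_, ?_⟩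
  · rw [Equiv.symm_apply_eq]
    refine (Fin.ext ?_)
    change 0 = (S i).card
    rw [eq_comm, Finset.card_eq_zero, Finset.eq_empty_iff_forall_notMem]
    intro y hy
    simp only [S, Finset.mem_filter, Finset.mem_univ, true_and] at hy
    exact hy.2 (reflTransGen_antisymm hy.1 (hG y))
  · intro x y
    rw [Equiv.symm_symm]
    change G.arrow x y ↔ (f x : ℕ) + 1 = f y
    constructor
    · intro hxy
      have h1 : f x < f y := hlt _ _ (ReflTransGen.single hxy) (G.arrow_ne hxy)
      -- If `y` did not come right after `x`, the vertex `z` in the next position would precede `y`.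
      -- But the walk from `x` to `z` must start with the only arrow out of `x`, which leads to `y`.
      obtain ⟨z, hz⟩ := e.surjective ⟨(f x : ℕ) + 1, by have := (f y).2; omega⟩
      have hz' : (f z : ℕ) = f x + 1 := congrArg Fin.val hz
      by_contra hne
      have h2 : f x < f z := by omega
      have h3 : f z < f y := by omega
      rcases ReflTransGen.cases_head (hlt' _ _ h2) with rfl | ⟨t, hxt, htz⟩
      · exact h2.ne rfl
      · rw [hu hxt hxy] at htz
        by_cases h4 : y = z
        · rw [h4] at h3
          exact h3.ne rfl
        · exact (hlt _ _ htz h4).not_gt h3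
    · intro h
      have h1 : f x < f y := by omega
      rcases ReflTransGen.cases_head (hlt' _ _ h1) with rfl | ⟨z, hxz, hzy⟩
      · exact absurd rfl h1.ne
      · by_cases h2 : z = y
        · rwa [h2] at hxz
        · have h3 := hlt _ _ hzy h2
          have h4 := hlt _ _ (ReflTransGen.single hxz) (G.arrow_ne hxz)
          omega

end Rooted

end OrientedTree

/-! ### Coefficients of vertex orderings and arrow reversal -/

section Coefficients

variable {V : Type*}

/-- Exactly one arrow joins `f j` and the vertices `f i`, `i < j`, and it points to `f j`. -/
def IsSoleArrow {N : ℕ} (r : V → V → Prop) (f : Fin N → V) (j : Fin N) : Prop :=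
  ∃ i < j, r (f i) (f j) ∧ ∀ i' < j, (r (f i') (f j) → i' = i) ∧ ¬ r (f j) (f i')

open Classical in
/-- The sign of the only arrow that joins `f j` to the vertices `f i`, `i < j`; zero if there is
not exactly one such arrow. -/
noncomputable def attachSign {N : ℕ} (r : V → V → Prop) (f : Fin N → V) (j : Fin N) : ℤ :=
  (if IsSoleArrow r f j then 1 else 0) - (if IsSoleArrow (flip r) f j then 1 else 0)

/-- The coefficient of the ordering `f` of the vertices in the iterated cobracket. -/
noncomputable def orderingCoeff {m : ℕ} (r : V → V → Prop) (f : Fin (m + 1) → V) : ℤ :=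
  ∏ j : Fin m, attachSign r f j.succ

theorem attachSign_flip {N : ℕ} (r : V → V → Prop) (f : Fin N → V) (j : Fin N) :
    attachSign (flip r) f j = -attachSign r f j := by
  unfold attachSign
  rw [neg_sub]
  rfl

/-- Only arrows between the entry at `j` and earlier entries matter. The two lengths are independent
so that an ordering can be compared with the one obtained by dropping its last vertex. -/
theorem isSoleArrow_congr {N N' : ℕ} {V' : Type*} {r : V → V → Prop} {r' : V' → V' → Prop}
    {f : Fin N → V} {f' : Fin N' → V'} {j : Fin N} {j' : Fin N'} (h : (j : ℕ) = j')
    (hr : ∀ (i : Fin N) (i' : Fin N'), (i : ℕ) = i' → i < j →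
      (r (f i) (f j) ↔ r' (f' i') (f' j')) ∧ (r (f j) (f i) ↔ r' (f' j') (f' i'))) :
    IsSoleArrow r f j ↔ IsSoleArrow r' f' j' := by
  have lt' : ∀ i : Fin N, i < j → ∀ h' : (i : ℕ) < N', (⟨i, h'⟩ : Fin N') < j' :=
    fun i hi _ => Fin.lt_def.2 (show (i : ℕ) < j' by omega)
  have lt : ∀ i : Fin N', i < j' → ∀ h' : (i : ℕ) < N, (⟨i, h'⟩ : Fin N) < j :=
    fun i hi _ => Fin.lt_def.2 (show (i : ℕ) < j by omega)
  constructor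
  · rintro ⟨i, hi, hij, hu⟩
    refine ⟨⟨i, by omega⟩, lt' i hi _, (hr i ⟨i, by omega⟩ rfl hi).1.1 hij, fun i' hi' => ?_⟩
    have h1 := hr ⟨i', by omega⟩ i' rfl (lt i' hi' _)
    have h2 := hu ⟨i', by omega⟩ (lt i' hi' _)
    rw [← h1.1, ← h1.2]
    exact ⟨fun h => Fin.ext (by simpa using Fin.ext_iff.1 (h2.1 h)), h2.2⟩
  · rintro ⟨i, hi, hij, hu⟩
    refine ⟨⟨i, by omega⟩, lt i hi _, (hr ⟨i, by omega⟩ i rfl (lt i hi _)).1.2 hij,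
      fun i' hi' => ?_⟩
    have h1 := hr i' ⟨i', by omega⟩ rfl hi'
    have h2 := hu ⟨i', by omega⟩ (lt' i' hi' _)
    rw [h1.1, h1.2]
    exact ⟨fun h => Fin.ext (by simpa using Fin.ext_iff.1 (h2.1 h)), h2.2⟩

theorem attachSign_congr {N N' : ℕ} {V' : Type*} {r : V → V → Prop} {r' : V' → V' → Prop}
    {f : Fin N → V} {f' : Fin N' → V'} {j : Fin N} {j' : Fin N'} (h : (j : ℕ) = j')
    (hr : ∀ (i : Fin N) (i' : Fin N'), (i : ℕ) = i' → i < j →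
      (r (f i) (f j) ↔ r' (f' i') (f' j')) ∧ (r (f j) (f i) ↔ r' (f' j') (f' i'))) :
    attachSign r f j = attachSign r' f' j' := by
  have h1 := isSoleArrow_congr h hr
  have h2 : IsSoleArrow (flip r) f j ↔ IsSoleArrow (flip r') f' j' :=
    isSoleArrow_congr h fun i i' hi hij => (hr i i' hi hij).symm
  classical
  exact congrArg₂ (· - ·) (if_congr h1 rfl rfl) (if_congr h2 rfl rfl)

-- One arrow from an earlier vertex to `f j` is given. It rules out the sign `-1`, and it is the
-- sole arrow exactly when the remaining arrows do not join `f j` to earlier vertices, a condition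
-- insensitive to its direction.
open Classical in
theorem attachSign_of_arrow {N : ℕ} {r r₀ : V → V → Prop} {f : Fin N → V}
    (hf : Function.Injective f) {i₀ j : Fin N} (hij : i₀ < j) (h₀ : ¬ r₀ (f i₀) (f j))
    (hr : ∀ x y, r x y ↔ r₀ x y ∨ (x = f i₀ ∧ y = f j)) :
    attachSign r f j =
      if ∀ i < j, ¬ r₀ (f i) (f j) ∧ ¬ r₀ (f j) (f i) then 1 else 0 := by
  have hne : ∀ i < j, f j ≠ f i := fun i hi h => hi.ne' (hf h)
  have h1 : ¬ IsSoleArrow (flip r) f j := by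
    rintro ⟨i, hi, hij', hu⟩
    exact (hu i₀ hij).2 ((hr _ _).2 (Or.inr ⟨rfl, rfl⟩))
  have h2 : IsSoleArrow r f j ↔ ∀ i < j, ¬ r₀ (f i) (f j) ∧ ¬ r₀ (f j) (f i) := by
    constructor
    · rintro ⟨i, hi, hij', hu⟩ i' hi'
      have h3 := (hu i₀ hij).1 ((hr _ _).2 (Or.inr ⟨rfl, rfl⟩))
      refine ⟨fun h => ?_, fun h => (hu i' hi').2 ((hr _ _).2 (Or.inl h))⟩
      have h4 := (hu i' hi').1 ((hr _ _).2 (Or.inl h))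
      rw [h4, ← h3] at h
      exact h₀ h
    · intro h
      refine ⟨i₀, hij, (hr _ _).2 (Or.inr ⟨rfl, rfl⟩), fun i' hi' => ⟨fun h3 => ?_, fun h3 => ?_⟩⟩
      · rcases (hr _ _).1 h3 with h4 | h4
        · exact absurd h4 (h i' hi').1
        · exact hf h4.1
      · rcases (hr _ _).1 h3 with h4 | h4
        · exact (h i' hi').2 h4
        · exact hne i₀ hij h4.1
  unfold attachSign
  rw [if_neg h1, sub_zero]
  simp only [h2]

/-- An arrow enters only the factor of its later end, and there reversal flips the sign (or leaves
zero). -/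
theorem orderingCoeff_reversal_aux {m : ℕ} {r r' r₀ : V → V → Prop} {f : Fin (m + 1) → V}
    (hf : Function.Injective f) {i₀ j₀ : Fin (m + 1)} (hij : i₀ < j₀) (h₀ : ¬ r₀ (f i₀) (f j₀))
    (h₀' : ¬ r₀ (f j₀) (f i₀))
    (hr : ∀ x y, r x y ↔ r₀ x y ∨ (x = f i₀ ∧ y = f j₀))
    (hr' : ∀ x y, r' x y ↔ r₀ x y ∨ (x = f j₀ ∧ y = f i₀)) :
    orderingCoeff r' f = -orderingCoeff r f := by
  classical
  have hj₀ : j₀ ≠ 0 := fun h => Fin.not_lt_zero i₀ (h ▸ hij)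
  obtain ⟨j₁, rfl⟩ := Fin.exists_succ_eq.2 hj₀
  have key : ∀ j : Fin m, attachSign r' f j.succ =
      attachSign r f j.succ * if j = j₁ then -1 else 1 := by
    intro j
    split_ifs with h
    · subst h
      have h1 := attachSign_of_arrow hf hij h₀ hr
      -- Flipping all arrows turns the reversed arrow back into one that points to the later vertex.
      have h2 := attachSign_of_arrow (r := flip r') (r₀ := flip r₀) hf hij h₀'
        (fun x y => (hr' y x).trans (by
          refine or_congr Iff.rfl ⟨fun h => ⟨h.2, h.1⟩, fun h => ⟨h.2, h.1⟩⟩))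
      have h3 : (∀ i < j.succ, ¬ flip r₀ (f i) (f j.succ) ∧ ¬ flip r₀ (f j.succ) (f i)) ↔
          ∀ i < j.succ, ¬ r₀ (f i) (f j.succ) ∧ ¬ r₀ (f j.succ) (f i) :=
        forall₂_congr fun i _ => and_comm
      rw [attachSign_flip] at h2
      simp only [h3] at h2
      rw [h1, ← neg_neg (attachSign r' f j.succ), h2]
      ring
    · rw [mul_one]
      have hne : j.succ ≠ j₁.succ := fun h' => h (Fin.succ_injective _ h')
      refine attachSign_congr rfl fun i i' hi hlt => ?_
      obtain rfl : i = i' := Fin.ext hi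
      rw [hr, hr, hr', hr']
      simp only [hf.eq_iff]
      grind
  unfold orderingCoeff
  rw [Finset.prod_congr rfl fun j _ => key j, Finset.prod_mul_distrib, Finset.prod_ite_eq' ]
  simp

theorem orderingCoeff_reversal {m : ℕ} {G G' : OrientedTree V} (h : G.ArrowReversal G')
    (e : Fin (m + 1) ≃ V) : orderingCoeff G.arrow e = -orderingCoeff G'.arrow e := by
  obtain ⟨r, a, b, hG, hG'⟩ := h
  have hab : ¬ r a b := fun h =>
    G'.isOrientedTree.1 a b ((hG' a b).2 (Or.inl h)) ((hG' b a).2 (Or.inr ⟨rfl, rfl⟩))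
  have hba : ¬ r b a := fun h =>
    G.isOrientedTree.1 a b ((hG a b).2 (Or.inr ⟨rfl, rfl⟩)) ((hG b a).2 (Or.inl h))
  obtain ⟨i, rfl⟩ := e.surjective a
  obtain ⟨j, rfl⟩ := e.surjective b
  have hne : i ≠ j := by
    rintro rfl
    exact G.arrow_ne ((hG _ _).2 (Or.inr ⟨rfl, rfl⟩)) rfl
  rcases lt_or_gt_of_ne hne with h | h
  · rw [orderingCoeff_reversal_aux e.injective h hab hba hG hG', neg_neg]
  · exact orderingCoeff_reversal_aux e.injective h hba hab hG' hG

end Coefficients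

/-! ### Linear extensions of rooted trees -/

namespace OrientedTree

variable {n m : ℕ}

/-- The ordering `e` of the vertices is a linear extension of `G`. -/
def IsLinearExtension (G : OrientedTree (Fin n)) (e : Fin (m + 1) ≃ Fin n) : Prop :=
  ∀ x y, G.arrow x y → e.symm x < e.symm y

/-- By induction on the position, parents come earlier. A nonzero factor gives an arrow between `e
j` and some earlier `e i`. It cannot point to `e i`, since `e j` would then be a parent of `e i` and
precede it. So it points to `e j` and comes from its unique parent. -/
theorem IsRootedAt.isLinearExtension_of_coeff_ne_zero {G : OrientedTree (Fin n)}
    {e : Fin (m + 1) ≃ Fin n} (hG : G.IsRootedAt (e 0)) (h : orderingCoeff G.arrow e ≠ 0) :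
    G.IsLinearExtension e := by
  have hadj : ∀ j : Fin m, ∃ i < j.succ,
      G.arrow (e i) (e j.succ) ∨ G.arrow (e j.succ) (e i) := by
    intro j
    by_contra! hcon
    refine h (Finset.prod_eq_zero (Finset.mem_univ j) ?_)
    unfold attachSign
    rw [if_neg, if_neg, sub_self]
    · rintro ⟨i, hi, hij, -⟩
      exact (hcon i hi).2 hij
    · rintro ⟨i, hi, hij, -⟩
      exact (hcon i hi).1 hij
  have key : ∀ (k : ℕ) (j : Fin (m + 1)), (j : ℕ) = k → ∀ x, G.arrow x (e j) → e.symm x < j := by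
    intro k
    induction k using Nat.strong_induction_on with
    | _ k ih =>
      intro j hj x hx
      induction j using Fin.cases with
      | zero => exact absurd (hG x) (not_reflTransGen_of_arrow hx)
      | succ j =>
        obtain ⟨i, hi, hij | hij⟩ := hadj j
        · rw [hG.parent_unique hij hx, Equiv.symm_apply_apply]
          exact hi
        · have h1 := ih i (by omega) i rfl _ hij
          rw [Equiv.symm_apply_apply] at h1
          exact absurd h1 hi.not_gt
  intro x y hxy
  refine key _ (e.symm y) rfl x ?_
  rwa [Equiv.apply_symm_apply]

/-- In a linear extension the earlier neighbours of a vertex are its parents. A vertex other than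
the root has exactly one. -/
theorem IsRootedAt.attachSign_eq_one {G : OrientedTree (Fin n)} {e : Fin (m + 1) ≃ Fin n}
    (hG : G.IsRootedAt (e 0)) (h : G.IsLinearExtension e) (j : Fin m) :
    attachSign G.arrow e j.succ = 1 := by
  have h1 : ¬ IsSoleArrow (flip G.arrow) e j.succ := by
    rintro ⟨i, hi, hij, -⟩
    have h1 := h _ _ hij
    rw [Equiv.symm_apply_apply, Equiv.symm_apply_apply] at h1
    exact h1.not_gt hi
  have h2 : IsSoleArrow G.arrow e j.succ := by
    rcases ReflTransGen.cases_tail (hG (e j.succ)) with h2 | ⟨u, -, hu⟩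
    · exact absurd (e.injective h2) (Fin.succ_ne_zero j)
    · refine ⟨e.symm u, ?_, ?_, fun i hi => ⟨fun h3 => ?_, fun h3 => ?_⟩⟩
      · simpa using h _ _ hu
      · rwa [Equiv.apply_symm_apply]
      · rw [← hG.parent_unique hu h3, Equiv.symm_apply_apply]
      · have h4 := h _ _ h3
        rw [Equiv.symm_apply_apply, Equiv.symm_apply_apply] at h4
        exact h4.not_gt hi
  unfold attachSign
  rw [if_pos h2, if_neg h1, sub_zero]

open Classical in
theorem IsRootedAt.orderingCoeff_eq {G : OrientedTree (Fin n)} {e : Fin (m + 1) ≃ Fin n}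
    (hG : G.IsRootedAt (e 0)) :
    orderingCoeff G.arrow e = if G.IsLinearExtension e then 1 else 0 := by
  split_ifs with h
  · exact Finset.prod_eq_one fun j _ => hG.attachSign_eq_one h j
  · by_contra h'
    exact h (hG.isLinearExtension_of_coeff_ne_zero h')

/-- The new arrow `b → c` imposes that `b` precede `c`, and together with `a → b` it implies the
constraint of the removed arrow `a → c`. -/
theorem isLinearExtension_slide {G G' : OrientedTree (Fin n)} {e : Fin (m + 1) ≃ Fin n}
    {a b c : Fin n} (hab : G.arrow a b) (hac : G.arrow a c) (hbc : b ≠ c)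
    (hG' : ∀ i j, G'.arrow i j ↔ (G.arrow i j ∧ ¬ (i = a ∧ j = c)) ∨ (i = b ∧ j = c)) :
    G'.IsLinearExtension e ↔ G.IsLinearExtension e ∧ e.symm b < e.symm c := by
  have h1 : G'.arrow a b := (hG' _ _).2 (Or.inl ⟨hab, fun h => hbc h.2⟩)
  have h2 : G'.arrow b c := (hG' _ _).2 (Or.inr ⟨rfl, rfl⟩)
  constructor
  · refine fun h => ⟨fun x y hxy => ?_, h _ _ h2⟩
    by_cases hx : x = a ∧ y = c
    · rw [hx.1, hx.2]
      exact (h _ _ h1).trans (h _ _ h2)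
    · exact h _ _ ((hG' _ _).2 (Or.inl ⟨hxy, hx⟩))
  · rintro ⟨h, hlt⟩ x y hxy
    rcases (hG' _ _).1 hxy with h3 | ⟨rfl, rfl⟩
    · exact h _ _ h3.1
    · exact hlt

/-- Each linear extension of the fork puts either `b` before `c` or `c` before `b`, and so extends
exactly one of the two slid trees. -/
theorem orderingCoeff_slide {G G' G'' : OrientedTree (Fin n)} {e : Fin (m + 1) ≃ Fin n}
    (hG : G.IsRootedAt (e 0)) (hrG' : G'.IsRootedAt (e 0)) (hrG'' : G''.IsRootedAt (e 0))
    {a b c : Fin n} (hab : G.arrow a b) (hac : G.arrow a c) (hbc : b ≠ c)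
    (hG' : ∀ i j, G'.arrow i j ↔ (G.arrow i j ∧ ¬ (i = a ∧ j = c)) ∨ (i = b ∧ j = c))
    (hG'' : ∀ i j, G''.arrow i j ↔ (G.arrow i j ∧ ¬ (i = a ∧ j = b)) ∨ (i = c ∧ j = b)) :
    orderingCoeff G.arrow e = orderingCoeff G'.arrow e + orderingCoeff G''.arrow e := by
  classical
  rw [hG.orderingCoeff_eq, hrG'.orderingCoeff_eq, hrG''.orderingCoeff_eq]
  simp only [isLinearExtension_slide hab hac hbc hG', isLinearExtension_slide hac hab hbc.symm hG'']
  have hne : e.symm b ≠ e.symm c := fun h => hbc (e.symm.injective h)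
  by_cases h : G.IsLinearExtension e
  · rcases lt_or_gt_of_ne hne with h1 | h1
    · simp [h, h1, h1.not_gt]
    · simp [h, h1, h1.not_gt]
  · simp [h]

theorem isLinearExtension_path {G : OrientedTree (Fin n)} {e : Fin (m + 1) ≃ Fin n}
    (he : ∀ x y, G.arrow x y ↔ (e.symm x : ℕ) + 1 = e.symm y) (σ : Fin (m + 1) ≃ Fin n) :
    G.IsLinearExtension σ ↔ σ = e := by
  constructor
  · intro h
    have hmono : StrictMono fun j => σ.symm (e j) := by
      refine Fin.strictMono_iff_lt_succ.2 fun j => h _ _ ((he _ _).2 ?_)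
      simp
    -- A finite chain has no order automorphism besides the identity.
    have hid : hmono.orderIsoOfSurjective _ (σ.symm.surjective.comp e.surjective) =
        OrderIso.refl _ := Subsingleton.elim _ _
    ext j
    have : σ.symm (e j) = j := DFunLike.congr_fun hid j
    rw [← (Equiv.symm_apply_eq σ).1 this]
  · rintro rfl x y hxy
    have := (he _ _).1 hxy
    omega

end OrientedTree

/-- The path `0 → 1 → ⋯ → m`. -/
def pathTree (m : ℕ) : OrientedTree (Fin (m + 1)) where
  arrow i j := (i : ℕ) + 1 = j
  isOrientedTree := by
    refine ⟨fun a b h h' => by omega, ?_⟩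
    have hadj : ∀ i j : Fin (m + 1),
        (SimpleGraph.fromRel fun i j : Fin (m + 1) => (i : ℕ) + 1 = j).Adj i j ↔
          (i : ℕ) + 1 = j ∨ (j : ℕ) + 1 = i := by
      intro i j
      rw [SimpleGraph.fromRel_adj, Fin.ne_iff_vne]
      omega
    refine ⟨(SimpleGraph.connected_iff_exists_forall_reachable _).2 ⟨0, fun v => ?_⟩, ?_⟩
    · induction v using Fin.induction with
      | zero => exact SimpleGraph.Reachable.refl _
      | succ i ih => exact ih.trans (SimpleGraph.Adj.reachable ((hadj _ _).2 (by simp)))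
    · rw [SimpleGraph.isAcyclic_iff_forall_adj_isBridge]
      -- Without the edge from `v` to `v + 1`, everything reachable from `v` is at most `v`.
      have key : ∀ v w : Fin (m + 1), (v : ℕ) + 1 = w → ¬ ((SimpleGraph.fromRel
          fun i j : Fin (m + 1) => (i : ℕ) + 1 = j).deleteEdges {s(v, w)}).Reachable v w := by
        intro v w hvw h
        rw [SimpleGraph.reachable_iff_reflTransGen] at h
        have : ∀ z, Relation.ReflTransGen ((SimpleGraph.fromRel
            fun i j : Fin (m + 1) => (i : ℕ) + 1 = j).deleteEdges {s(v, w)}).Adj v z → z ≤ v := by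
          intro z hz
          induction hz with
          | refl => exact le_rfl
          | @tail x y _ hxy ih =>
            rw [SimpleGraph.deleteEdges_adj, hadj, Set.mem_singleton_iff, Sym2.eq_iff] at hxy
            by_contra hy
            refine hxy.2 (Or.inl ⟨Fin.ext ?_, Fin.ext ?_⟩) <;> omega
        have := this w h
        omega
      intro v w hvw
      rw [SimpleGraph.isBridge_iff]
      rcases (hadj _ _).1 hvw with h | h
      · exact key v w h
      · intro h'
        rw [Sym2.eq_swap] at h'
        exact key w v h h'.symm

/-! ### The iterated cobracket as a sum over orderings -/

section IteratedCobracket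

variable (k : Type*) [Field k] {W : ℤ → Type*} [∀ d, AddCommGroup (W d)] [∀ d, Module k (W d)]

/-- The class of the tree with a single vertex. -/
noncomputable def pointClass (z : Σ d, W d) : GraphSpace k W := cls k ⟨1, pathTree 0, fun _ => z⟩

theorem koszulSign_of_subsingleton {n m : ℕ} [Subsingleton (Fin n)] (d : Fin n → ℤ)
    (f : Fin n → Fin m) : koszulSign d f = 1 :=
  Finset.prod_eq_one fun _ _ => Finset.prod_eq_one fun _ _ =>
    if_neg fun h => h.1.ne (Subsingleton.elim _ _)

theorem clsRaw_eq_pointClass {n : ℕ} (hn : n = 1) (r : Fin n → Fin n → Prop)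
    (hr : ∀ i j, ¬ r i j) (w : Fin n → Σ d, W d) (z : Σ d, W d) (hw : ∀ i, w i = z) :
    clsRaw k r w = pointClass k z := by
  subst hn
  rw [clsRaw_perm k r (pathTree 0).arrow w (fun _ => z) (Equiv.refl _) ?_ hw,
    koszulSign_of_subsingleton, one_smul]
  · exact dif_pos (pathTree 0).isOrientedTree
  · intro i j
    refine iff_of_false (hr i j) fun h => ?_
    change (i : ℕ) + 1 = j at h
    omega

theorem cls_eq_pointClass (x : LabeledTree W) (hx : x.size = 1) (i : Fin x.size) :
    cls k x = pointClass k (x.label i) := by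
  have hsub : ∀ j, j = i := fun j => Fin.ext (by omega)
  rw [← clsRaw_eq_pointClass k hx x.graph.arrow (fun a b h => ?_) x.label _
    (fun j => by rw [hsub j])]
  · rw [clsRaw, dif_pos x.graph.isOrientedTree]
  · exact x.graph.arrow_ne h (by rw [hsub a, hsub b])

theorem clsOn_singleton {n : ℕ} (G : OrientedTree (Fin n)) (w : Fin n → Σ d, W d) (v : Fin n)
    (S : Finset (Fin n)) (hS : S = {v}) : clsOn k G.arrow w S = pointClass k (w v) := by
  have hv : ∀ i, S.orderEmbOfFin rfl i = v := fun i => by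
    have h := S.orderEmbOfFin_mem rfl i
    generalize S.orderEmbOfFin rfl i = u at h ⊢
    rwa [hS, Finset.mem_singleton] at h
  refine clsRaw_eq_pointClass k (by rw [hS, Finset.card_singleton]) _ (fun i j h => ?_) _ _
    fun i => by rw [hv]
  exact G.arrow_ne h (by rw [hv, hv])

theorem clsOn_of_isCut {n : ℕ} (G : OrientedTree (Fin n)) (w : Fin n → Σ d, W d)
    (S : Finset (Fin n)) (h : IsCut G.arrow S ∨ IsCut G.arrow Sᶜ) :
    clsOn k G.arrow w S =
      cls k ⟨S.card, ⟨_, isOrientedTree_on G S h⟩, fun i => w (S.orderEmbOfFin rfl i)⟩ :=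
  dif_pos (isOrientedTree_on G S h)

theorem isCut_flip_compl {n : ℕ} (r : Fin n → Fin n → Prop) (S : Finset (Fin n)) :
    IsCut (flip r) Sᶜ ↔ IsCut r S := by
  unfold IsCut flip
  constructor
  · rintro ⟨a, b, hab, ha, hb, h⟩
    refine ⟨b, a, hab, by simpa using hb, by simpa using ha, fun i j hij => ?_⟩
    rcases h j i hij with h | h
    · left
      simpa only [Finset.mem_compl, not_iff_not, iff_comm] using h
    · exact Or.inr h.symm
  · rintro ⟨a, b, hab, ha, hb, h⟩
    refine ⟨b, a, hab, by simpa using hb, by simpa using ha, fun i j hij => ?_⟩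
    rcases h j i hij with h | h
    · left
      simpa only [Finset.mem_compl, not_iff_not, iff_comm] using h
    · exact Or.inr h.symm

/-- The vertices before the last one are all the others, so the last vertex has a sole arrow exactly
when it can be cut off as a leaf. -/
theorem isSoleArrow_last {n m : ℕ} (r : Fin n → Fin n → Prop)
    (e : Fin (m + 1) ≃ Fin n) :
    IsSoleArrow r e (Fin.last m) ↔ IsCut r {e (Fin.last m)}ᶜ := by
  have hlast : ∀ i, i < Fin.last m ↔ e i ≠ e (Fin.last m) := fun i => by
    rw [e.injective.ne_iff, Fin.lt_last_iff_ne_last]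
  unfold IsSoleArrow IsCut
  simp only [Finset.mem_compl, Finset.mem_singleton, hlast]
  constructor
  · rintro ⟨i, hi, hij, hu⟩
    refine ⟨e i, _, hij, hi, not_not.2 rfl, fun x y hxy => ?_⟩
    obtain ⟨x, rfl⟩ := e.surjective x
    obtain ⟨y, rfl⟩ := e.surjective y
    by_cases hx : e x = e (Fin.last m)
    · by_cases hy : e y = e (Fin.last m)
      · exact Or.inl (by simp [hx, hy])
      · rw [hx] at hxy
        exact absurd hxy (hu y hy).2
    · by_cases hy : e y = e (Fin.last m)
      · rw [hy] at hxy
        exact Or.inr ⟨by rw [(hu x hx).1 hxy], hy⟩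
      · exact Or.inl (by simp [hx, hy])
  · rintro ⟨a, b, hab, ha, hb, hu⟩
    obtain ⟨a, rfl⟩ := e.surjective a
    rw [not_not] at hb
    subst hb
    refine ⟨a, ha, hab, fun i hi => ⟨fun h => ?_, fun h => ?_⟩⟩
    · rcases hu _ _ h with h1 | h1
      · exact absurd rfl (h1.1 hi)
      · exact e.injective h1.1
    · rcases hu _ _ h with h1 | h1
      · exact absurd rfl (h1.2 hi)
      · exact absurd h1.2 hi

open Classical in
theorem attachSign_last {n m : ℕ} (G : OrientedTree (Fin n)) (e : Fin (m + 1) ≃ Fin n) :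
    attachSign G.arrow e (Fin.last m) =
      (if IsCut G.arrow {e (Fin.last m)}ᶜ then 1 else 0) -
        (if IsCut G.arrow {e (Fin.last m)} then 1 else 0) := by
  have h1 := isSoleArrow_last G.arrow e
  have h2 := isSoleArrow_last (flip G.arrow) e
  rw [isCut_flip_compl] at h2
  exact congrArg₂ (· - ·) (if_congr h1 rfl rfl) (if_congr h2 rfl rfl)

/-- The ordering `e` of all vertices ends with `v` and extends the ordering `e'` of the other
vertices. -/
def IsExtension {n m : ℕ} (v : Fin n) (S : Finset (Fin n)) (e' : Fin (m + 1) ≃ Fin S.card)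
    (e : Fin (m + 2) ≃ Fin n) : Prop :=
  e (Fin.last (m + 1)) = v ∧ ∀ i, e i.castSucc = S.orderEmbOfFin rfl (e' i)

theorem exists_isExtension {m : ℕ} {v : Fin (m + 2)} {S : Finset (Fin (m + 2))} (hS : S = {v}ᶜ)
    (e' : Fin (m + 1) ≃ Fin S.card) : ∃ e, IsExtension v S e' e := by
  let f : Fin (m + 2) → Fin (m + 2) := Fin.snoc (fun i => S.orderEmbOfFin rfl (e' i)) v
  have hlast : f (Fin.last (m + 1)) = v := Fin.snoc_last _ _
  have hcast : ∀ i : Fin (m + 1), f i.castSucc = S.orderEmbOfFin rfl (e' i) :=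
    fun i => Fin.snoc_castSucc _ _ i
  have hne : ∀ i, S.orderEmbOfFin rfl i ≠ v := fun i => by
    have h := S.orderEmbOfFin_mem rfl i
    generalize S.orderEmbOfFin rfl i = u at h ⊢
    simpa [hS] using h
  have hinj : Function.Injective f := by
    intro i j h
    induction i using Fin.lastCases with
    | last =>
      induction j using Fin.lastCases with
      | last => rfl
      | cast j =>
        rw [hlast, hcast] at h
        exact absurd h.symm (hne _)
    | cast i =>
      induction j using Fin.lastCases with
      | last =>
        rw [hlast, hcast] at h
        exact absurd h (hne _)
      | cast j =>
        rw [hcast, hcast] at h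
        rw [e'.injective ((S.orderEmbOfFin rfl).injective h)]
  exact ⟨Equiv.ofBijective f (Finite.injective_iff_bijective.1 hinj), hlast, hcast⟩

theorem exists_isExtension_of_last {m : ℕ} {v : Fin (m + 2)} {S : Finset (Fin (m + 2))}
    (hS : S = {v}ᶜ) (e : Fin (m + 2) ≃ Fin (m + 2)) (he : e (Fin.last (m + 1)) = v) :
    ∃ e' : Fin (m + 1) ≃ Fin S.card, IsExtension v S e' e := by
  have hmem : ∀ i : Fin (m + 1), e i.castSucc ∈ S := fun i => by
    rw [hS, Finset.mem_compl, Finset.mem_singleton, ← he, e.injective.eq_iff]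
    exact (Fin.castSucc_lt_last i).ne
  choose f hf using fun i => exists_orderEmb S _ (hmem i)
  have hinj : Function.Injective f := by
    intro i j h
    have h1 := hf i
    rw [h, hf j, e.injective.eq_iff] at h1
    exact (Fin.castSucc_injective _ h1).symm
  have hcard : Fintype.card (Fin (m + 1)) = Fintype.card (Fin S.card) := by
    rw [Fintype.card_fin, Fintype.card_fin, hS, Finset.card_compl, Fintype.card_fin,
      Finset.card_singleton]
    rfl
  exact ⟨Equiv.ofBijective f ((Fintype.bijective_iff_injective_and_card f).2 ⟨hinj, hcard⟩), he,
    fun i => (hf i).symm⟩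

/-- Appending `v` is a bijection from the orderings of the other vertices to the orderings that end
with `v`. -/
theorem sum_isExtension {m : ℕ} {M : Type*} [AddCommMonoid M] {v : Fin (m + 2)}
    {S : Finset (Fin (m + 2))} (hS : S = {v}ᶜ) (F' : (Fin (m + 1) ≃ Fin S.card) → M)
    (F : (Fin (m + 2) ≃ Fin (m + 2)) → M) (h : ∀ e' e, IsExtension v S e' e → F' e' = F e) :
    ∑ e', F' e' = ∑ e with e (Fin.last (m + 1)) = v, F e := by
  choose ext hext using fun e' => exists_isExtension (m := m) hS e'
  refine Finset.sum_bij (fun e' _ => ext e') ?_ ?_ ?_ fun e' _ => h _ _ (hext e')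
  · intro e' _
    exact Finset.mem_filter.2 ⟨Finset.mem_univ _, (hext e').1⟩
  · intro e₁ _ e₂ _ h12
    refine Equiv.ext fun i => (S.orderEmbOfFin rfl).injective ?_
    rw [← (hext e₁).2, ← (hext e₂).2]
    exact DFunLike.congr_fun h12 _
  · intro e he
    obtain ⟨e', he'⟩ := exists_isExtension_of_last hS e (Finset.mem_filter.1 he).2
    refine ⟨e', Finset.mem_univ _, Equiv.ext fun i => ?_⟩
    induction i using Fin.lastCases with
    | last => rw [(hext e').1, he'.1]
    | cast i => rw [(hext e').2, he'.2]

theorem IsExtension.orderingCoeff_eq {n m : ℕ} {v : Fin n} {S : Finset (Fin n)}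
    {e' : Fin (m + 1) ≃ Fin S.card} {e : Fin (m + 2) ≃ Fin n} (h : IsExtension v S e' e)
    (r : Fin n → Fin n → Prop) : orderingCoeff r e =
      orderingCoeff (fun i j => r (S.orderEmbOfFin rfl i) (S.orderEmbOfFin rfl j)) e' *
        attachSign r e (Fin.last (m + 1)) := by
  unfold orderingCoeff
  rw [Fin.prod_univ_castSucc, Fin.succ_last]
  congr 1
  refine Finset.prod_congr rfl fun j _ => attachSign_congr (by simp) fun i i' hi hlt => ?_
  obtain rfl : i = i'.castSucc := Fin.ext hi
  rw [Fin.succ_castSucc, h.2, h.2]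
  exact ⟨Iff.rfl, Iff.rfl⟩

/-- Reordering by `e` amounts to moving `v` to the end and then reordering the rest. In
`sign_identity` the block `{v}` contributes no inversion, and the target unshuffle is trivial
because `v` already sits last. -/
theorem IsExtension.koszulSign_eq {n m : ℕ} {v : Fin n} {S : Finset (Fin n)} (hS : S = {v}ᶜ)
    {e' : Fin (m + 1) ≃ Fin S.card} {e : Fin (m + 2) ≃ Fin n} (h : IsExtension v S e' e)
    (d : Fin n → ℤ) : unshuffleSign d S Sᶜ *
      koszulSign (fun i => d (S.orderEmbOfFin rfl i)) e'.symm = koszulSign d e.symm := by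
  have hmem : ∀ i, i ∈ S ↔ i ≠ v := fun i => by simp [hS]
  have key := sign_identity d (fun i => d (e i)) e.symm (fun i => by simp) S
  have h1 : unshuffleSign (fun i => d (e i)) (S.map e.symm.toEmbedding)
      (S.map e.symm.toEmbedding)ᶜ = 1 := by
    refine Finset.prod_eq_one fun i _ => Finset.prod_eq_one fun j hj => if_neg ?_
    obtain ⟨a, rfl⟩ := e.symm.surjective j
    rw [← mem_compl_map, Finset.mem_compl, hmem, not_not, ← h.1] at hj
    rw [hj, Equiv.symm_apply_apply]
    exact (Fin.le_last i).not_gt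
  have h2 : (∏ i ∈ Sᶜ, ∏ j ∈ Sᶜ, if i < j ∧ e.symm j < e.symm i then (d i * d j).negOnePow
      else 1) = 1 := by
    refine Finset.prod_eq_one fun i hi => Finset.prod_eq_one fun j hj => if_neg fun hlt => ?_
    rw [Finset.mem_compl, hmem, not_not] at hi hj
    exact hlt.1.ne (hi.trans hj.symm)
  have h3 : ∀ i, e.symm (S.orderEmbOfFin rfl i) = (e'.symm i).castSucc := fun i => by
    rw [Equiv.symm_apply_eq, h.2, Equiv.apply_symm_apply]
  have h4 : (∏ i ∈ S, ∏ j ∈ S, if i < j ∧ e.symm j < e.symm i then (d i * d j).negOnePow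
      else 1) = koszulSign (fun i => d (S.orderEmbOfFin rfl i)) e'.symm := by
    rw [← prod_orderEmb]
    refine Finset.prod_congr rfl fun i _ => ?_
    rw [← prod_orderEmb]
    refine Finset.prod_congr rfl fun j _ => ?_
    simp only [h3, OrderEmbedding.lt_iff_lt, Fin.castSucc_lt_castSucc_iff]
  rw [h1, h2, h4, mul_one, mul_one] at key
  exact key

theorem mulEquiv_tprod_pointwise {M : Type*} [AddCommGroup M] [Module k M] {m : ℕ}
    (a : Fin m → M) (b : M) :
    TensorPower.mulEquiv (R := k) (M := M) (n := m) (m := 1)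
      (PiTensorProduct.tprod k a ⊗ₜ[k] PiTensorProduct.tprod k fun _ => b) =
      PiTensorProduct.tprod k (Fin.snoc (α := fun _ => M) a b) := by
  have h := TensorPower.tprod_mul_tprod k a (fun _ : Fin 1 => b)
  rw [TensorPower.gMul_def, Fin.append_right_eq_snoc] at h
  exact h

/-- The map `δ ↦ (]·[^m ⊗ id) ∘ δ` that defines the iterated cobracket. -/
noncomputable def iterStep (m : ℕ) :
    GraphSpace k W ⊗[k] GraphSpace k W →ₗ[k] ⨂[k]^(m + 1 + 1) (GraphSpace k W) :=
  (TensorPower.mulEquiv (R := k) (M := GraphSpace k W) (n := m + 1) (m := 1)).toLinearMap ∘ₗ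
    TensorProduct.map (iterCobracket (graphCobracket k W) m)
      (PiTensorProduct.subsingletonEquiv (R := k)
        (s := fun _ : Fin 1 => GraphSpace k W) 0).symm.toLinearMap

theorem iterCobracket_succ (m : ℕ) (z : GraphSpace k W) :
    iterCobracket (graphCobracket k W) (m + 1) z = iterStep k m (graphCobracket k W z) := rfl

theorem iterStep_tmul (m : ℕ) (y z : GraphSpace k W) :
    iterStep k m (y ⊗ₜ[k] z) = TensorPower.mulEquiv (R := k) (n := m + 1) (m := 1)
      (iterCobracket (graphCobracket k W) m y ⊗ₜ[k] PiTensorProduct.tprod k fun _ => z) := by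
  rw [iterStep, LinearMap.comp_apply, TensorProduct.map_tmul, LinearEquiv.coe_coe,
    LinearEquiv.coe_coe, PiTensorProduct.subsingletonEquiv_symm_apply']

theorem iterStep_cutTerm (m : ℕ) {n : ℕ} (r : Fin n → Fin n → Prop) (w : Fin n → Σ d, W d)
    (S : Finset (Fin n)) : iterStep k m (cutTerm k r w S) =
      ((unshuffleSign (fun i => (w i).1) S Sᶜ : ℤ) : k) •
        TensorPower.mulEquiv (R := k) (n := m + 1) (m := 1)
          (iterCobracket (graphCobracket k W) m (clsOn k r w S) ⊗ₜ[k]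
            PiTensorProduct.tprod k fun _ => clsOn k r w Sᶜ) := by
  rw [cutTerm, Units.smul_def, ← Int.cast_smul_eq_zsmul k, map_smul, iterStep_tmul]

-- The terms are collected by their left factor `S`: it occurs positively when an arrow leaves `S`,
-- and negatively, as target side, when an arrow leaves `Sᶜ`.
open Classical in
theorem iterStep_treeCobracket (m : ℕ) {n : ℕ} (G : OrientedTree (Fin n))
    (w : Fin n → Σ d, W d) : iterStep k m (treeCobracket k ⟨n, G, w⟩) =
      ∑ S, (((if IsCut G.arrow S then 1 else 0) - (if IsCut G.arrow Sᶜ then 1 else 0) : ℤ) : k) •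
        iterStep k m (cutTerm k G.arrow w S) := by
  have h1 : ∀ S, (if IsCut G.arrow S then cutTerm k G.arrow w S - cutTerm k G.arrow w Sᶜ else 0) =
      (if IsCut G.arrow S then 1 else 0 : ℤ) • cutTerm k G.arrow w S -
        (if IsCut G.arrow S then 1 else 0 : ℤ) • cutTerm k G.arrow w Sᶜ := fun S => by
    split_ifs <;> simp
  have h2 : ∑ S, (if IsCut G.arrow S then 1 else 0 : ℤ) • cutTerm k G.arrow w Sᶜ =
      ∑ S, (if IsCut G.arrow Sᶜ then 1 else 0 : ℤ) • cutTerm k G.arrow w S :=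
    Fintype.sum_equiv (compl_involutive.toPerm _) _ _ fun S => by
      simp [Function.Involutive.coe_toPerm]
  rw [treeCobracket_eq, Finset.sum_congr rfl fun S _ => h1 S, Finset.sum_sub_distrib, h2,
    ← Finset.sum_sub_distrib, map_sum]
  refine Finset.sum_congr rfl fun S _ => ?_
  rw [← sub_smul, ← Int.cast_smul_eq_zsmul k, map_smul]

/-- The summand of the iterated cobracket that corresponds to an ordering of the vertices. -/
noncomputable def orderingTerm {m : ℕ} (x : LabeledTree W) (e : Fin (m + 1) ≃ Fin x.size) :
    ⨂[k]^(m + 1) (GraphSpace k W) :=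
  ((orderingCoeff x.graph.arrow e * koszulSign x.deg e.symm : ℤ) : k) •
    PiTensorProduct.tprod k fun j => pointClass k (x.label (e j))

theorem iterCobracket_zero_cls (x : LabeledTree W) (hx : x.size ≤ 1) :
    iterCobracket (graphCobracket k W) 0 (cls k x) = ∑ e, orderingTerm k (m := 0) x e := by
  obtain ⟨n, G, w⟩ := x
  change n ≤ 1 at hx
  have hne : Nonempty (Fin n) := G.isOrientedTree.2.1.nonempty
  have hn : n = 1 := by
    have := Fin.pos_iff_nonempty.2 hne
    omega
  subst hn
  rw [Fintype.sum_subsingleton _ (Equiv.refl (Fin 1))]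
  have h1 : koszulSign (LabeledTree.deg ⟨1, G, w⟩) (Equiv.refl (Fin 1)).symm = 1 :=
    koszulSign_of_subsingleton _ _
  rw [orderingTerm, h1, orderingCoeff, Finset.univ_eq_empty, Finset.prod_empty, Units.val_one,
    mul_one, Int.cast_one, one_smul, iterCobracket, LinearEquiv.coe_coe,
    PiTensorProduct.subsingletonEquiv_symm_apply']
  congr 1
  funext j
  exact cls_eq_pointClass k ⟨1, G, w⟩ rfl _

/-- A left part with too few vertices to be cut `m` times admits no ordering of length `m + 1`, so
its sum is empty. -/
theorem iterStep_cutTerm_eq_zero {m n : ℕ}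
    (ih : ∀ x : LabeledTree W, x.size ≤ m + 1 →
      iterCobracket (graphCobracket k W) m (cls k x) = ∑ e, orderingTerm k x e)
    (G : OrientedTree (Fin n)) (w : Fin n → Σ d, W d) (S : Finset (Fin n))
    (h : IsCut G.arrow S ∨ IsCut G.arrow Sᶜ) (hS : S.card < m + 1) :
    iterStep k m (cutTerm k G.arrow w S) = 0 := by
  have hempty : IsEmpty (Fin (m + 1) ≃ Fin S.card) := ⟨fun e => by
    have := Fin.equiv_iff_eq.1 ⟨e⟩
    omega⟩
  have h0 : iterCobracket (graphCobracket k W) m (clsOn k G.arrow w S) = 0 := by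
    rw [clsOn_of_isCut k G w S h, ih _ hS.le]
    exact Finset.sum_of_isEmpty _
  rw [iterStep_cutTerm, h0, TensorProduct.zero_tmul, map_zero,
    smul_zero]

-- Detaching `v` as right factor and ordering the remaining vertices by the induction hypothesis
-- yields the orderings that end with `v`. The coefficient of the cut is their last factor.
open Classical in
theorem iterStep_cutTerm_compl_singleton {m : ℕ}
    (ih : ∀ x : LabeledTree W, x.size ≤ m + 1 →
      iterCobracket (graphCobracket k W) m (cls k x) = ∑ e, orderingTerm k x e)
    (G : OrientedTree (Fin (m + 2))) (w : Fin (m + 2) → Σ d, W d) (v : Fin (m + 2))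
    (S : Finset (Fin (m + 2))) (hS : S = {v}ᶜ) :
    (((if IsCut G.arrow S then 1 else 0) - (if IsCut G.arrow Sᶜ then 1 else 0) : ℤ) : k) •
        iterStep k m (cutTerm k G.arrow w S) =
      ∑ e with e (Fin.last (m + 1)) = v, orderingTerm k ⟨m + 2, G, w⟩ e := by
  have hSc : Sᶜ = {v} := by rw [hS, compl_compl]
  have hsign : ∀ e : Fin (m + 2) ≃ Fin (m + 2), e (Fin.last (m + 1)) = v →
      attachSign G.arrow e (Fin.last (m + 1)) =
        (if IsCut G.arrow S then 1 else 0) - (if IsCut G.arrow Sᶜ then 1 else 0) := by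
    intro e he
    rw [attachSign_last, he, hSc, hS]
  by_cases h : IsCut G.arrow S ∨ IsCut G.arrow Sᶜ
  · have hcard : S.card = m + 1 := by
      rw [hS, Finset.card_compl, Fintype.card_fin, Finset.card_singleton]
      rfl
    rw [iterStep_cutTerm, clsOn_of_isCut k G w S h,
      ih _ hcard.le, TensorProduct.sum_tmul, map_sum, Finset.smul_sum, Finset.smul_sum]
    refine sum_isExtension hS _ _ fun e' e hext => ?_
    rw [← hsign e hext.1, clsOn_singleton k G w v _ hSc]
    unfold orderingTerm
    change _ • _ • TensorPower.mulEquiv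
      (((orderingCoeff (fun i j => G.arrow (S.orderEmbOfFin rfl i) (S.orderEmbOfFin rfl j)) e' *
        koszulSign (fun i => (w (S.orderEmbOfFin rfl i)).1) e'.symm : ℤ) : k) •
        (PiTensorProduct.tprod k fun j => pointClass k (w (S.orderEmbOfFin rfl (e' j)))) ⊗ₜ[k] _) =
      ((orderingCoeff G.arrow e * koszulSign (fun i => (w i).1) e.symm : ℤ) : k) •
        PiTensorProduct.tprod k fun j => pointClass k (w (e j))
    rw [hext.orderingCoeff_eq, ← hext.koszulSign_eq hS (fun i => (w i).1),
      map_smul, mulEquiv_tprod_pointwise, smul_smul, smul_smul,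
      Units.val_mul, ← Int.cast_mul, ← Int.cast_mul]
    congr 1
    · congr 1
      ring
    · congr 1
      funext j
      induction j using Fin.lastCases with
      | last => rw [Fin.snoc_last, hext.1]
      | cast j => rw [Fin.snoc_castSucc, hext.2]
  · rw [not_or] at h
    rw [if_neg h.1, if_neg h.2, sub_self, Int.cast_zero, zero_smul]
    -- If `v` cannot be cut off, the last factor of each of these orderings vanishes too.
    symm
    refine Finset.sum_eq_zero fun e he => ?_
    have h1 := hsign e (Finset.mem_filter.1 he).2
    rw [if_neg h.1, if_neg h.2, sub_self] at h1
    have h2 : orderingCoeff G.arrow e = 0 :=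
      Finset.prod_eq_zero (Finset.mem_univ (Fin.last m)) (by rw [Fin.succ_last]; exact h1)
    rw [orderingTerm]
    change ((orderingCoeff G.arrow e * _ : ℤ) : k) • _ = _
    rw [h2, zero_mul, Int.cast_zero, zero_smul]

theorem IsCut.card_lt {n : ℕ} {r : Fin n → Fin n → Prop} {S : Finset (Fin n)}
    (h : IsCut r S ∨ IsCut r Sᶜ) : S.card < n := by
  have : ∃ b, b ∉ S := by
    rcases h with ⟨a, b, -, -, hb, -⟩ | ⟨a, b, -, ha, -, -⟩
    · exact ⟨b, hb⟩
    · exact ⟨a, Finset.mem_compl.1 ha⟩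
  obtain ⟨b, hb⟩ := this
  conv_rhs => rw [← Fintype.card_fin n]
  exact Finset.card_lt_univ_of_notMem hb

/-- The iterated cobracket as a sum over the orderings of the vertices. -/
theorem iterCobracket_cls (m : ℕ) (x : LabeledTree W) (hx : x.size ≤ m + 1) :
    iterCobracket (graphCobracket k W) m (cls k x) = ∑ e, orderingTerm k x e := by
  classical
  -- Sizes below `m + 1` are included so that the induction also yields the vanishing on small left
  -- parts, where the sum over orderings is empty.
  induction m generalizing x with
  | zero => exact iterCobracket_zero_cls k x hx
  | succ m ih =>
    obtain ⟨n, G, w⟩ := x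
    change n ≤ m + 2 at hx
    rw [iterCobracket_succ, graphCobracket_cls, iterStep_treeCobracket]
    have hzero : ∀ S : Finset (Fin n), S.card ≠ m + 1 →
        (((if IsCut G.arrow S then 1 else 0) -
          (if IsCut G.arrow Sᶜ then 1 else 0) : ℤ) : k) •
            iterStep k m (cutTerm k G.arrow w S) = 0 := by
      intro S hS
      by_cases h : IsCut G.arrow S ∨ IsCut G.arrow Sᶜ
      · have := IsCut.card_lt h
        rw [iterStep_cutTerm_eq_zero k ih G w S h (by omega), smul_zero]
      · rw [not_or] at h
        rw [if_neg h.1, if_neg h.2, sub_self, Int.cast_zero, zero_smul]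
    rcases hx.lt_or_eq with hlt | rfl
    · have hempty : IsEmpty (Fin (m + 1 + 1) ≃ Fin n) := ⟨fun e => by
        have := Fin.equiv_iff_eq.1 ⟨e⟩
        omega⟩
      refine Eq.trans (Finset.sum_eq_zero fun S _ => ?_) (Finset.sum_of_isEmpty _).symm
      by_cases h : IsCut G.arrow S ∨ IsCut G.arrow Sᶜ
      · have := IsCut.card_lt h
        exact hzero S (by omega)
      · rw [not_or] at h
        rw [if_neg h.1, if_neg h.2, sub_self, Int.cast_zero, zero_smul]
    -- Only complements of single vertices survive. They match the grouping of the orderings by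
    -- their last vertex.
    · have hinj : Function.Injective fun v : Fin (m + 2) => ({v}ᶜ : Finset (Fin (m + 2))) :=
        compl_injective.comp Finset.singleton_injective
      rw [← Finset.sum_subset (Finset.subset_univ
        (Finset.univ.image fun v : Fin (m + 2) => ({v}ᶜ : Finset (Fin (m + 2))))),
        Finset.sum_image hinj.injOn,
        ← Finset.sum_fiberwise Finset.univ (fun e : Fin (m + 2) ≃ Fin (m + 2) =>
          e (Fin.last (m + 1)))]
      · exact Finset.sum_congr rfl fun v _ => iterStep_cutTerm_compl_singleton k ih G w v _ rfl
      · intro S _ hS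
        refine hzero S fun hcard => hS ?_
        have h1 : Sᶜ.card = 1 := by
          rw [Finset.card_compl, hcard, Fintype.card_fin]
          omega
        obtain ⟨v, hv⟩ := Finset.card_eq_one.1 h1
        exact Finset.mem_image.2 ⟨v, Finset.mem_univ _, by rw [← hv, compl_compl]⟩

end IteratedCobracket

/-! ### Expansion of trees into paths in the Lie coalgebra -/

section WordProblem

variable (k : Type*) [Field k] {W : ℤ → Type*} [∀ d, AddCommGroup (W d)] [∀ d, Module k (W d)]

/-- The class of a labelled tree in the Lie coalgebra. -/
noncomputable def lieCls (x : LabeledTree W) : LieSpace k W := (arn k W).mkQ (cls k x)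

theorem lieCls_reversal {n : ℕ} {G G' : OrientedTree (Fin n)} (h : G.ArrowReversal G')
    (w : Fin n → Σ d, W d) : lieCls k ⟨n, G, w⟩ = -lieCls k ⟨n, G', w⟩ := by
  rw [eq_neg_iff_add_eq_zero, lieCls, lieCls, ← map_add]
  exact mkQ_arn k (ArnRel.reverse G G' w h)

/-- This is the Arnold relation up to reversals. Reversing `a → c` in `G` gives `X` with `c → a →
b`, of class `-G`. Reversing both arrows of `a → c → b` in `G''` gives `Z` with `b → c → a`, of the
same class as `G''`. The relation `G' + Z + X = 0` is the claim. -/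
theorem lieCls_slide {n : ℕ} {G G' G'' : OrientedTree (Fin n)} {a b c : Fin n}
    (hab : G.arrow a b) (hac : G.arrow a c) (hbc : b ≠ c)
    (hG' : ∀ i j, G'.arrow i j ↔ (G.arrow i j ∧ ¬ (i = a ∧ j = c)) ∨ (i = b ∧ j = c))
    (hG'' : ∀ i j, G''.arrow i j ↔ (G.arrow i j ∧ ¬ (i = a ∧ j = b)) ∨ (i = c ∧ j = b))
    (w : Fin n → Σ d, W d) :
    lieCls k ⟨n, G, w⟩ = lieCls k ⟨n, G', w⟩ + lieCls k ⟨n, G'', w⟩ := by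
  have n1 := G.not_arrow_siblings hab hac
  have n2 := G.not_arrow_siblings hac hab
  have n3 := G.isOrientedTree.1 _ _ hab
  have n4 := G.isOrientedTree.1 _ _ hac
  have n5 := G.arrow_ne hab
  have n6 := G.arrow_ne hac
  obtain ⟨X, hX, hX'⟩ := G.exists_reverse hac
  obtain ⟨Y, hY, hY'⟩ := G''.exists_reverse ((hG'' a c).2 (Or.inl ⟨hac, fun h => hbc h.2.symm⟩))
  obtain ⟨Z, hZ, hZ'⟩ := Y.exists_reverse (a := c) (b := b)
    ((hY' c b).2 (Or.inl ⟨(hG'' _ _).2 (Or.inr ⟨rfl, rfl⟩), fun h => n6 h.1.symm⟩))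
  have harn : OrientedTree.ArnoldTriple G' Z X := by
    refine ⟨fun i j => G.arrow i j ∧ ¬ (i = a ∧ j = b) ∧ ¬ (i = a ∧ j = c), a, b, c,
      fun h => h.2.1 ⟨rfl, rfl⟩, fun h => n1 h.1, fun h => n4 h.1, ?_, ?_, ?_⟩
    · intro i j
      rw [hG']
      grind
    · intro i j
      rw [hZ', hY', hG'']
      grind
    · intro i j
      rw [hX']
      grind
  have h := mkQ_arn k (ArnRel.arnold G' Z X w harn)
  rw [map_add, map_add] at h
  change lieCls k _ + lieCls k _ + lieCls k _ = 0 at h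
  rw [lieCls_reversal k hX, lieCls_reversal k hY w, lieCls_reversal k hZ w, neg_neg, eq_comm,
    ← sub_eq_zero, sub_neg_eq_add]
  exact h

/-- In the Lie coalgebra, a tree is a combination of the paths starting at a given vertex `i`. -/
theorem sum_paths_eq {m : ℕ} (i : Fin (m + 1)) (w : Fin (m + 1) → Σ d, W d)
    (G : OrientedTree (Fin (m + 1))) :
    ∑ e : Fin (m + 1) ≃ Fin (m + 1) with e 0 = i,
      ((orderingCoeff G.arrow e * koszulSign (fun j => (w j).1) e.symm : ℤ) : k) •
        lieCls k ⟨m + 1, pathTree m, fun j => w (e j)⟩ = lieCls k ⟨m + 1, G, w⟩ := by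
  refine OrientedTree.reverse_induction i (fun G => ∑ e : Fin (m + 1) ≃ Fin (m + 1) with e 0 = i,
      ((orderingCoeff G.arrow e * koszulSign (fun j => (w j).1) e.symm : ℤ) : k) •
        lieCls k ⟨m + 1, pathTree m, fun j => w (e j)⟩ = lieCls k ⟨m + 1, G, w⟩) ?_ ?_ G
  · intro G G' h ih
    rw [lieCls_reversal k h, ← ih, ← Finset.sum_neg_distrib]
    refine Finset.sum_congr rfl fun e _ => ?_
    rw [orderingCoeff_reversal h, neg_mul, Int.cast_neg, neg_smul]
  refine OrientedTree.slide_induction i _ ?_ ?_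
  · intro G G' G'' hG hG' hG'' a b c hab hac hbc h' h'' ih' ih''
    rw [lieCls_slide k hab hac hbc h' h'', ← ih', ← ih'', ← Finset.sum_add_distrib]
    refine Finset.sum_congr rfl fun e he => ?_
    obtain rfl := (Finset.mem_filter.1 he).2
    rw [OrientedTree.orderingCoeff_slide hG hG' hG'' hab hac hbc h' h'', add_mul, Int.cast_add,
      add_smul]
  -- A path has a single linear extension `e`. Renumbering its vertices along `e` costs exactly the
  -- Koszul sign in the sum.
  · intro G hG hu
    obtain ⟨e, rfl, he⟩ := hG.exists_path hu
    rw [Finset.sum_eq_single e]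
    · rw [hG.orderingCoeff_eq, if_pos ((OrientedTree.isLinearExtension_path he e).2 rfl), one_mul]
      have h := cls_perm k (⟨m + 1, G, w⟩ : LabeledTree W)
        ⟨m + 1, pathTree m, fun j => w (e j)⟩ e.symm he
        (fun j => congrArg w (e.apply_symm_apply j).symm)
      unfold lieCls
      rw [h, Units.smul_def, map_zsmul, ← Int.cast_smul_eq_zsmul k]
      rfl
    · intro σ hσ hne
      have hG' : G.IsRootedAt (σ 0) := by rwa [(Finset.mem_filter.1 hσ).2]
      rw [hG'.orderingCoeff_eq, if_neg fun h => hne ((OrientedTree.isLinearExtension_path he σ).1 h),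
        zero_mul, Int.cast_zero, zero_smul]
    · intro h
      exact (h (by rw [Finset.mem_filter]; exact ⟨Finset.mem_univ _, rfl⟩)).elim

/-! ### Projection to the cogenerators -/

open Classical in
/-- The label of a tree with a single vertex; zero for larger trees. -/
noncomputable def pointLabel (x : LabeledTree W) : DirectSum ℤ W :=
  if h : x.size = 1 then
    DirectSum.lof k ℤ W (x.label ⟨0, by omega⟩).1 (x.label ⟨0, by omega⟩).2
  else 0

theorem pointLabel_of_size {x : LabeledTree W} (h : x.size = 1) (i : Fin x.size) :
    pointLabel k x = DirectSum.lof k ℤ W (x.label i).1 (x.label i).2 := by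
  obtain rfl : i = ⟨0, by omega⟩ := Fin.ext (by have := i.2; simp; omega)
  exact dif_pos h

theorem pointLabel_of_ne {x : LabeledTree W} (h : x.size ≠ 1) : pointLabel k x = 0 := dif_neg h

theorem graphRel_le_ker_pointLabel : Submodule.span k {z | GraphRel k W z} ≤
    LinearMap.ker (Finsupp.linearCombination k (pointLabel (W := W) k)) := by
  rw [Submodule.span_le]
  rintro z (⟨G, w, i, d, a, b⟩ | ⟨G, w, i, d, c, a⟩ | ⟨x, y, σ, harrow, hlabel⟩)
  · rename_i n
    rw [SetLike.mem_coe, LinearMap.mem_ker]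
    simp only [map_sub, Finsupp.linearCombination_single, one_smul]
    by_cases hn : n = 1
    · have key : ∀ z : W d, pointLabel k ⟨n, G, Function.update w i ⟨d, z⟩⟩ =
          DirectSum.lof k ℤ W d z := fun z => by
        rw [pointLabel_of_size k hn i]
        change DirectSum.lof k ℤ W (Function.update w i ⟨d, z⟩ i).1
          (Function.update w i ⟨d, z⟩ i).2 = _
        rw [Function.update_self]
      rw [key, key, key, map_add]
      abel
    · rw [pointLabel_of_ne k hn, pointLabel_of_ne k hn, pointLabel_of_ne k hn, sub_zero, sub_zero]
  · rename_i n
    rw [SetLike.mem_coe, LinearMap.mem_ker]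
    simp only [map_sub, map_smul, Finsupp.linearCombination_single, one_smul]
    by_cases hn : n = 1
    · have key : ∀ z : W d, pointLabel k ⟨n, G, Function.update w i ⟨d, z⟩⟩ =
          DirectSum.lof k ℤ W d z := fun z => by
        rw [pointLabel_of_size k hn i]
        change DirectSum.lof k ℤ W (Function.update w i ⟨d, z⟩ i).1
          (Function.update w i ⟨d, z⟩ i).2 = _
        rw [Function.update_self]
      rw [key, key, map_smul, sub_self]
    · rw [pointLabel_of_ne k hn, pointLabel_of_ne k hn, smul_zero, sub_zero]
  · rw [SetLike.mem_coe, LinearMap.mem_ker, Units.smul_def, map_sub, map_zsmul]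
    simp only [Finsupp.linearCombination_single, one_smul]
    have hsize : x.size = y.size := Fin.equiv_iff_eq.1 ⟨σ⟩
    by_cases hx : x.size = 1
    · have hsub : Subsingleton (Fin x.size) := by rw [hx]; infer_instance
      rw [koszulSign_of_subsingleton, Units.val_one, one_smul,
        pointLabel_of_size k hx ⟨0, by omega⟩, hlabel,
        ← pointLabel_of_size k (hsize.symm.trans hx), sub_self]
    · rw [pointLabel_of_ne k hx, pointLabel_of_ne k fun h => hx (hsize.trans h), smul_zero,
        sub_zero]

/-- The projection of the graph coalgebra to its cogenerators. -/
noncomputable def cogenerators : GraphSpace k W →ₗ[k] DirectSum ℤ W :=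
  (Submodule.span k {z | GraphRel k W z}).liftQ
    (Finsupp.linearCombination k (pointLabel k)) (graphRel_le_ker_pointLabel k)

theorem cogenerators_cls (x : LabeledTree W) : cogenerators k (cls k x) = pointLabel k x := by
  have h : cogenerators k (cls k x) =
      Finsupp.linearCombination k (pointLabel (W := W) k) (Finsupp.single x 1) := rfl
  rw [h, Finsupp.linearCombination_single, one_smul]

theorem cogenerators_pointClass (z : Σ d, W d) :
    cogenerators k (pointClass k z) = DirectSum.lof k ℤ W z.1 z.2 := by
  rw [pointClass, cogenerators_cls, pointLabel_of_size k rfl 0]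

theorem pointLabel_of_arrow {n : ℕ} {G : OrientedTree (Fin n)} {a b : Fin n} (h : G.arrow a b)
    (w : Fin n → Σ d, W d) : pointLabel k ⟨n, G, w⟩ = 0 := by
  refine pointLabel_of_ne k fun hn => G.arrow_ne h ?_
  change n = 1 at hn
  subst hn
  exact Subsingleton.elim _ _

/-- Every tree in a reversal or Arnold expression has an arrow, hence more than one vertex, and
projects to zero. -/
theorem arn_le_ker_cogenerators : arn k W ≤ LinearMap.ker (cogenerators k) := by
  unfold arn
  rw [Submodule.span_le]
  rintro z (⟨G, G', w, r, a, b, h, h'⟩ | ⟨G₁, G₂, G₃, w, r, a, b, c, -, -, -, h₁, h₂, h₃⟩)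
  · rw [SetLike.mem_coe, LinearMap.mem_ker, map_add, cogenerators_cls, cogenerators_cls,
      pointLabel_of_arrow k ((h a b).2 (Or.inr ⟨rfl, rfl⟩)),
      pointLabel_of_arrow k ((h' b a).2 (Or.inr ⟨rfl, rfl⟩)), add_zero]
  · rw [SetLike.mem_coe, LinearMap.mem_ker, map_add, map_add, cogenerators_cls, cogenerators_cls,
      cogenerators_cls, pointLabel_of_arrow k ((h₁ a b).2 (Or.inr (Or.inl ⟨rfl, rfl⟩))),
      pointLabel_of_arrow k ((h₂ b c).2 (Or.inr (Or.inl ⟨rfl, rfl⟩))),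
      pointLabel_of_arrow k ((h₃ c a).2 (Or.inr (Or.inl ⟨rfl, rfl⟩))), add_zero, add_zero]

/-- The inclusion of the cogenerators as trees with a single vertex. -/
noncomputable def ofCogenerators : DirectSum ℤ W →ₗ[k] GraphSpace k W :=
  DirectSum.toModule k ℤ _ fun d =>
    { toFun := fun a => pointClass k ⟨d, a⟩
      map_add' := fun a b => by
        have h := cls_add k (pathTree 0) (fun _ => (⟨d, a⟩ : Σ d, W d)) 0 d a b
        have e : ∀ z : W d, Function.update (fun _ : Fin 1 => (⟨d, a⟩ : Σ d, W d)) 0 ⟨d, z⟩ =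
            fun _ => ⟨d, z⟩ := fun z => by
          funext j
          rw [Subsingleton.elim j 0, Function.update_self]
        rw [e, e, e] at h
        exact h
      map_smul' := fun c a => by
        have h := cls_smul k (pathTree 0) (fun _ => (⟨d, a⟩ : Σ d, W d)) 0 d c a
        have e : ∀ z : W d, Function.update (fun _ : Fin 1 => (⟨d, a⟩ : Σ d, W d)) 0 ⟨d, z⟩ =
            fun _ => ⟨d, z⟩ := fun z => by
          funext j
          rw [Subsingleton.elim j 0, Function.update_self]
        rw [e, e] at h
        exact h }

theorem ofCogenerators_cogenerators (v : GraphSpace k W) (hv : v ∈ graphWeight k W 1) :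
    ofCogenerators k (cogenerators k v) = v := by
  refine Submodule.span_induction (p := fun v _ => ofCogenerators k (cogenerators k v) = v)
    ?_ ?_ ?_ ?_ hv
  · rintro _ ⟨x, hx, rfl⟩
    rw [cls_eq_pointClass k x hx ⟨0, by omega⟩, cogenerators_pointClass, ofCogenerators,
      DirectSum.toModule_lof]
    rfl
  · rw [map_zero, map_zero]
  · intro x y _ _ hx hy
    rw [map_add, map_add, hx, hy]
  · intro c x _ hx
    rw [map_smul, map_smul, hx]

/-! ### Reading tensors as paths -/

/-- The path `0 → ⋯ → m` with given labels, as a multilinear function of the labels. -/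
noncomputable def pathMultilinear (m : ℕ) (d : Fin (m + 1) → ℤ) :
    MultilinearMap k (fun j => W (d j)) (LieSpace k W) :=
  have key : ∀ (_ : DecidableEq (Fin (m + 1))) (a : ∀ j, W (d j)) (i) (z : W (d i)),
      (fun j => (⟨d j, Function.update a i z j⟩ : Σ d, W d)) =
        Function.update (fun j => ⟨d j, a j⟩) i ⟨d i, z⟩ := fun _ a i z => by
    funext j
    by_cases h : j = i
    · subst h
      simp
    · simp [h]
  { toFun := fun a => lieCls k ⟨m + 1, pathTree m, fun j => ⟨d j, a j⟩⟩
    map_update_add' := fun {inst} a i x y => by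
      obtain rfl : inst = instDecidableEqFin (m + 1) := Subsingleton.elim _ _
      unfold lieCls
      rw [key, key, key, cls_add, map_add]
    map_update_smul' := fun {inst} a i c x => by
      obtain rfl : inst = instDecidableEqFin (m + 1) := Subsingleton.elim _ _
      unfold lieCls
      rw [key, key, cls_smul, map_smul] }

/-- The map sending `w₀ ⊗ ⋯ ⊗ wₘ` to the path `0 → ⋯ → m` with labels `w₀, …, wₘ`. -/
noncomputable def pathMap (m : ℕ) : ⨂[k]^(m + 1) (GraphSpace k W) →ₗ[k] LieSpace k W :=
  -- The projection to cogenerators extends the map to all tensors of graphs; a factor with more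
  -- than one vertex gives zero.
  PiTensorProduct.lift ((MultilinearMap.fromDirectSumEquiv (R := k) (κ := fun _ => ℤ)
    (M := fun _ => W) (pathMultilinear k m)).compLinearMap fun _ => cogenerators k)

theorem pathMap_tprod (m : ℕ) (z : Fin (m + 1) → Σ d, W d) :
    pathMap k m (PiTensorProduct.tprod k fun j => pointClass k (z j)) =
      lieCls k ⟨m + 1, pathTree m, z⟩ := by
  rw [pathMap, PiTensorProduct.lift.tprod, MultilinearMap.compLinearMap_apply]
  simp only [cogenerators_pointClass]
  exact MultilinearMap.fromDirectSumEquiv_lof (R := k) (κ := fun _ => ℤ) (M := fun _ => W)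
    (pathMultilinear k m) (fun j => (z j).1) fun j => (z j).2

/-- The orderings are grouped by their first vertex. By `sum_paths_eq` each of the `m + 1` groups
contributes the class of the tree once. -/
theorem pathMap_iterCobracket (m : ℕ) (γ : GraphSpace k W) (hγ : γ ∈ graphWeight k W (m + 1)) :
    pathMap k m (iterCobracket (graphCobracket k W) m γ) = ((m + 1 : ℕ) : k) •
      (arn k W).mkQ γ := by
  refine Submodule.span_induction (p := fun γ _ =>
    pathMap k m (iterCobracket (graphCobracket k W) m γ) = ((m + 1 : ℕ) : k) •
      (arn k W).mkQ γ) ?_ ?_ ?_ ?_ hγ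
  · rintro _ ⟨⟨n, G, w⟩, hx, rfl⟩
    change n = m + 1 at hx
    subst hx
    rw [iterCobracket_cls k m _ le_rfl, map_sum,
      ← Finset.sum_fiberwise Finset.univ (fun e : Fin (m + 1) ≃ Fin (m + 1) => e 0)]
    have key : ∀ i : Fin (m + 1), ∑ e : Fin (m + 1) ≃ Fin (m + 1) with e 0 = i,
        pathMap k m (orderingTerm k ⟨m + 1, G, w⟩ e) = lieCls k ⟨m + 1, G, w⟩ := by
      intro i
      rw [← sum_paths_eq k i w G]
      refine Finset.sum_congr rfl fun e _ => ?_
      rw [orderingTerm, map_smul, pathMap_tprod]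
      rfl
    rw [Finset.sum_congr rfl fun i _ => key i, Finset.sum_const, Finset.card_univ,
      Fintype.card_fin, Nat.cast_smul_eq_nsmul]
    rfl
  · rw [map_zero, map_zero, map_zero, smul_zero]
  · intro x y _ _ hx hy
    rw [map_add, map_add, map_add, hx, hy, smul_add]
  · intro c x _ hx
    rw [map_smul, map_smul, map_smul, hx, smul_comm]

/-! ### Tensors of single vertices and passage to the quotient -/

/-- The tensors all of whose factors are trees with a single vertex. -/
noncomputable def pointTensors (m : ℕ) : Submodule k (⨂[k]^(m + 1) (GraphSpace k W)) :=
  Submodule.span k {t | ∃ v : Fin (m + 1) → GraphSpace k W,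
    (∀ i, v i ∈ graphWeight k W 1) ∧ t = PiTensorProduct.tprod k v}

theorem iterCobracket_mem_pointTensors (m : ℕ) (γ : GraphSpace k W)
    (hγ : γ ∈ graphWeight k W (m + 1)) :
    iterCobracket (graphCobracket k W) m γ ∈ pointTensors k m := by
  refine Submodule.span_induction (p := fun γ _ =>
    iterCobracket (graphCobracket k W) m γ ∈ pointTensors k m) ?_ ?_ ?_ ?_ hγ
  · rintro _ ⟨x, hx, rfl⟩
    rw [iterCobracket_cls k m x hx.le]
    refine Submodule.sum_mem _ fun e _ => Submodule.smul_mem _ _ (Submodule.subset_span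
      ⟨_, fun i => Submodule.subset_span ⟨_, rfl, rfl⟩, rfl⟩)
  · rw [map_zero]
    exact Submodule.zero_mem _
  · intro x y _ _ hx hy
    rw [map_add]
    exact Submodule.add_mem _ hx hy
  · intro c x _ hx
    rw [map_smul]
    exact Submodule.smul_mem _ _ hx

/-- The linear map between tensor powers induced by a linear map. -/
noncomputable def tensorPowerMap {C D : Type*} [AddCommGroup C] [Module k C] [AddCommGroup D]
    [Module k D] (f : C →ₗ[k] D) (m : ℕ) : ⨂[k]^m C →ₗ[k] ⨂[k]^m D :=
  PiTensorProduct.map fun _ => f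

theorem tensorPowerMap_tprod {C D : Type*} [AddCommGroup C] [Module k C] [AddCommGroup D]
    [Module k D] (f : C →ₗ[k] D) {m : ℕ} (a : Fin m → C) :
    tensorPowerMap k f m (PiTensorProduct.tprod k a) = PiTensorProduct.tprod k fun i => f (a i) :=
  PiTensorProduct.map_tprod _ _

/-- The projection to cogenerators descends to the quotient. Followed by the inclusion of single
vertices, it inverts the quotient map factor by factor. -/
theorem map_mkQ_injOn_pointTensors (m : ℕ) (t : ⨂[k]^(m + 1) (GraphSpace k W))
    (ht : t ∈ pointTensors k m) (h : tensorPowerMap k (arn k W).mkQ (m + 1) t = 0) :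
    t = 0 := by
  let f : LieSpace k W →ₗ[k] GraphSpace k W :=
    ofCogenerators k ∘ₗ (arn k W).liftQ (cogenerators k) (arn_le_ker_cogenerators k)
  have hf : ∀ v, f ((arn k W).mkQ v) = ofCogenerators k (cogenerators k v) := fun v => rfl
  have key : tensorPowerMap k f (m + 1)
      (tensorPowerMap k (arn k W).mkQ (m + 1) t) = t := by
    refine Submodule.span_induction (p := fun t _ => tensorPowerMap k f (m + 1)
      (tensorPowerMap k (arn k W).mkQ (m + 1) t) = t) ?_ ?_ ?_ ?_ ht
    · rintro _ ⟨v, hv, rfl⟩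
      rw [tensorPowerMap_tprod, tensorPowerMap_tprod]
      congr 1
      funext i
      rw [hf, ofCogenerators_cogenerators k _ (hv i)]
    · rw [map_zero, map_zero]
    · intro x y _ _ hx hy
      rw [map_add, map_add, hx, hy]
    · intro c x _ hx
      rw [map_smul, map_smul, hx]
  rw [← key, h, map_zero]

theorem map_mulEquiv {C D : Type*} [AddCommGroup C] [Module k C] [AddCommGroup D] [Module k D]
    (f : C →ₗ[k] D) {m n : ℕ} (s : ⨂[k]^m C) (t : ⨂[k]^n C) :
    tensorPowerMap k f (m + n) (TensorPower.mulEquiv (R := k) (s ⊗ₜ[k] t)) =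
      TensorPower.mulEquiv (R := k)
        (tensorPowerMap k f m s ⊗ₜ[k] tensorPowerMap k f n t) := by
  induction s using PiTensorProduct.induction_on with
  | smul_tprod c a =>
    induction t using PiTensorProduct.induction_on with
    | smul_tprod c' b =>
      have h1 := TensorPower.tprod_mul_tprod k a b
      have h2 := TensorPower.tprod_mul_tprod k (fun i => f (a i)) (fun i => f (b i))
      rw [TensorPower.gMul_def] at h1 h2
      simp only [map_smul, ← TensorProduct.smul_tmul', TensorProduct.tmul_smul,
        tensorPowerMap_tprod]
      rw [h1, h2, tensorPowerMap_tprod]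
      congr 3
      funext i
      induction i using Fin.addCases with
      | left i => rw [Fin.append_left, Fin.append_left]
      | right i => rw [Fin.append_right, Fin.append_right]
    | add x y hx hy =>
      rw [TensorProduct.tmul_add, map_add, map_add, hx, hy, map_add, TensorProduct.tmul_add,
        map_add]
  | add x y hx hy =>
    rw [TensorProduct.add_tmul, map_add, map_add, hx, hy, map_add, TensorProduct.add_tmul, map_add]

/-- Iterated cobrackets are natural for coalgebra maps; this is applied to the quotient map. -/
theorem iterCobracket_comp {C D : Type*} [AddCommGroup C] [Module k C] [AddCommGroup D]
    [Module k D] (δ : C →ₗ[k] C ⊗[k] C) (δ' : D →ₗ[k] D ⊗[k] D) (f : C →ₗ[k] D)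
    (h : ∀ z, δ' (f z) = TensorProduct.map f f (δ z)) (m : ℕ) (z : C) :
    iterCobracket δ' m (f z) = tensorPowerMap k f (m + 1) (iterCobracket δ m z) := by
  induction m generalizing z with
  | zero =>
    rw [iterCobracket, iterCobracket, LinearEquiv.coe_coe, LinearEquiv.coe_coe,
      PiTensorProduct.subsingletonEquiv_symm_apply', PiTensorProduct.subsingletonEquiv_symm_apply',
      tensorPowerMap_tprod]
  | succ m ih =>
    rw [iterCobracket, iterCobracket, LinearMap.comp_apply, LinearMap.comp_apply,
      LinearMap.comp_apply, LinearMap.comp_apply, h, LinearEquiv.coe_coe, LinearEquiv.coe_coe]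
    generalize δ z = t
    induction t using TensorProduct.induction_on with
    | zero => simp only [map_zero]
    | tmul x y =>
      rw [TensorProduct.map_tmul, TensorProduct.map_tmul, TensorProduct.map_tmul, map_mulEquiv, ih,
        LinearEquiv.coe_coe, LinearEquiv.coe_coe, PiTensorProduct.subsingletonEquiv_symm_apply',
        PiTensorProduct.subsingletonEquiv_symm_apply', tensorPowerMap_tprod]
    | add x y hx hy => simp only [map_add, hx, hy]

theorem iterCobracket_mkQ (m : ℕ) (γ : GraphSpace k W) :
    iterCobracket (lieCobracket k W) m ((arn k W).mkQ γ) =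
      tensorPowerMap k (arn k W).mkQ (m + 1) (iterCobracket (graphCobracket k W) m γ) :=
  iterCobracket_comp k (graphCobracket k W) (lieCobracket k W) (arn k W).mkQ (fun _ => rfl) m γ

theorem mem_arn_iff_iterCobracket_eq_zero [CharZero k] (m : ℕ) (γ : GraphSpace k W)
    (hγ : γ ∈ graphWeight k W (m + 1)) :
    γ ∈ arn k W ↔ iterCobracket (graphCobracket k W) m γ = 0 := by
  constructor
  · intro h
    refine map_mkQ_injOn_pointTensors k m _ (iterCobracket_mem_pointTensors k m γ hγ) ?_
    rw [← iterCobracket_mkQ, Submodule.mkQ_apply, (Submodule.Quotient.mk_eq_zero _).2 h, map_zero]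
  · intro h
    have h1 := pathMap_iterCobracket k m γ hγ
    rw [h, map_zero, eq_comm, smul_eq_zero] at h1
    -- Characteristic zero enters here, to cancel the factor `m + 1`.
    exact (Submodule.Quotient.mk_eq_zero _).1
      (h1.resolve_left (Nat.cast_ne_zero.2 (Nat.succ_ne_zero m)))

end WordProblem

end GraphCoalgebra

theorem mainTheorem7 {k : Type*} [Field k] [CharZero k]
    (W : ℤ → Type*) [∀ d, AddCommGroup (W d)] [∀ d, Module k (W d)] (n : ℕ) (hn : 1 ≤ n) :
    (∀ g ∈ GraphCoalgebra.lieWeight k W n,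
      g = 0 ↔ GraphCoalgebra.iterCobracket (GraphCoalgebra.lieCobracket k W) (n - 1) g = 0) ∧
    (∀ γ ∈ GraphCoalgebra.graphWeight k W n,
      GraphCoalgebra.iterCobracket (GraphCoalgebra.graphCobracket k W) (n - 1) γ ∈
        Submodule.span k {t | ∃ v : Fin (n - 1 + 1) → GraphCoalgebra.GraphSpace k W,
          (∀ i, v i ∈ GraphCoalgebra.graphWeight k W 1) ∧ t = PiTensorProduct.tprod k v} ∧
      (γ ∈ GraphCoalgebra.arn k W ↔
        GraphCoalgebra.iterCobracket (GraphCoalgebra.graphCobracket k W) (n - 1) γ = 0)) := by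
  obtain ⟨m, rfl⟩ : ∃ m, n = m + 1 := ⟨n - 1, by omega⟩
  refine ⟨?_, fun γ hγ => ⟨GraphCoalgebra.iterCobracket_mem_pointTensors k m γ hγ,
    GraphCoalgebra.mem_arn_iff_iterCobracket_eq_zero k m γ hγ⟩⟩
  rintro _ ⟨γ, hγ, rfl⟩
  refine ⟨fun h => by rw [h, map_zero], fun h => ?_⟩
  change GraphCoalgebra.iterCobracket (GraphCoalgebra.lieCobracket k W) m _ = 0 at h
  rw [GraphCoalgebra.iterCobracket_mkQ] at h
  -- Vanishing in the tensor power of the quotient lifts to graphs, where the second part of the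
  -- statement applies.
  have h1 := GraphCoalgebra.map_mkQ_injOn_pointTensors k m _
    (GraphCoalgebra.iterCobracket_mem_pointTensors k m γ hγ) h
  exact (Submodule.Quotient.mk_eq_zero _).2
    ((GraphCoalgebra.mem_arn_iff_iterCobracket_eq_zero k m γ hγ).2 h1)
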